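/- Let $N\ge 1$ be an integer and let $\Pi$ be a set of two-coloured partitions containing the four mixed-coloured pair partitions (two points, one white and one black in either order, both upper or both lower, forming one block). A two-coloured partition $p$ has $k$ upper points with colours $\omega\in\{1,*\}^k$ and $l$ lower points with colours $\omega'\in\{1,*\}^l$ (white $=1$, black $=*$). A labeling of the points of a row by $[N]=\{1,\dots,N\}$ is valid if points of that row in the same block have equal labels. Let $T_0\subseteq[N]^k$ and $T_0'\subseteq[N]^l$ be the non-valid labelings of the upper and of the lower row. Let $T_1,\dots,T_r$ and $T_1',\dots,T_r'$, $r=N^{tb(p)}$, be the sets of valid labelings of the upper, respectively lower, row that restrict to the $i$-th labeling of the $tb(p)$ through-blocks (the blocks containing both upper and lower points). For a matrix $y=(y_{ij})$ over a $*$-algebra write $y^{\omega}_{s,t}=y_{s_1t_1}^{\omega_1}\cdots y_{s_kt_k}^{\omega_k}$ (equal to $1$ if $k=0$). The relations $R^{Gr}_p(u)$ for an $N\times N$ matrix $u$ are: (i) $\sum_{t\in T_i}u^{\omega}_{t,\gamma}=\sum_{t'\in T'_j}u^{\omega'}_{\gamma',t'}$ for $1\le i,j\le r$, $\gamma\in T_j$,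 $\gamma'\in T_i'$; (ii) $\sum_{t\in T_i}u^{\omega}_{t,\gamma}=0$ for $1\le i\le r$, $\gamma\in T_0$; (iii) $\sum_{t'\in T'_j}u^{\omega'}_{\gamma',t'}=0$ for $1\le j\le r$, $\gamma'\in T_0'$. The relations $R^{Sp}_p(x)$ for an $N\times N$ matrix $x$ are: (i) $\sum_{t\in T_i}x^{\omega}_{t,\gamma}=\sum_{t'\in T'_i}x^{\omega'}_{t',\gamma'}$ for $1\le i,j\le r$, $\gamma\in T_j$, $\gamma'\in T'_j$; (ii) $\sum_{t\in T_i}x^{\omega}_{t,\gamma}=0$ for $1\le i\le r$, $\gamma\in T_0$; (iii) $\sum_{t'\in T'_i}x^{\omega'}_{t',\gamma'}=0$ for $1\le i\le r$, $\gamma'\in T'_0$. Let $C(G_N(\Pi))$ be the universal unital $C^*$-algebra generated by the entries of $u=(u_{ij})_{1\le i,j\le N}$ subject to $R^{Gr}_p(u)$ for all $p\in\Pi$, and let $C(X_{N,N}(\Pi))$ be the universal unital $C^*$-algebra generated by the entries of $x=(x_{ij})_{1\le i,j\le N}$ subject to $R^{Sp}_p(x)$ for all $p\in\Pi$. A compact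 matrix quantum group $G$ is a unital $C^*$-algebra $C(G)$ generated by the entries of a matrix $v=(v_{ij})_{1\le i,j\le N}$ such that $v$ and $\bar v=(v_{ij}^*)$ are invertible and there is a unital $*$-homomorphism $\Delta:C(G)\to C(G)\otimes C(G)$ with $\Delta(v_{ij})=\sum_k v_{ik}\otimes v_{kj}$, where $\otimes$ is the minimal tensor product. A left (right) matrix-vector action of $G$ on $X_{N,N}(\Pi)$ is a unital $*$-homomorphism $C(X_{N,N}(\Pi))\to C(G)\otimes C(X_{N,N}(\Pi))$ with $x_{ij}\mapsto\sum_k v_{ik}\otimes x_{kj}$ (respectively $x_{ij}\mapsto\sum_k v_{ki}\otimes x_{kj}$) for all $i,j$. A quantum symmetry group of $X_{N,N}(\Pi)$ is a compact matrix quantum group $G$ with left and right matrix-vector actions on $X_{N,N}(\Pi)$ that is maximal: for every compact matrix quantum group $G'$ with fundamental $N\times N$ matrix $v'$ having such left and right actions, there is a $*$-homomorphism $C(G)\to C(G')$ with $v_{ij}\mapsto v'_{ij}$ for all $i,j$. Then $G_N(\Pi)$, with fundamental matrix $u$, is a quantum symmetry group of $X_{N,N}(\Pi)$. Moreover, it is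 the only one: for every quantum symmetry group $G$ of $X_{N,N}(\Pi)$ with fundamental matrix $v$ there is a $*$-isomorphism $C(G_N(\Pi))\to C(G)$ with $u_{ij}\mapsto v_{ij}$ for all $i,j$. -/

import Mathlib

open scoped TensorProduct

universe u v w

noncomputable section

/-- A C*-seminorm on a unital complex *-algebra `F`: a submultiplicative seminorm satisfying
`p (a* a) = p a ^ 2`. These are exactly the functions `a ↦ ‖π a‖` for unital *-homomorphisms `π`
from `F` to a unital C*-algebra. -/
structure CStarSeminorm (F : Type*) [Ring F] [StarRing F] [Algebra ℂ F] where
  toSeminorm : Seminorm ℂ F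
  mul_le : ∀ a b, toSeminorm (a * b) ≤ toSeminorm a * toSeminorm b
  star_mul_self : ∀ a, toSeminorm (star a * a) = toSeminorm a ^ 2

namespace CStarSeminorm

section Basic

variable {F : Type*} [Ring F] [StarRing F] [Algebra ℂ F]

instance : CoeFun (CStarSeminorm F) (fun _ => F → ℝ) := ⟨fun p => p.toSeminorm⟩

lemma nonneg (p : CStarSeminorm F) (a : F) : 0 ≤ p a := apply_nonneg p.toSeminorm a

lemma le_star (p : CStarSeminorm F) (a : F) : p a ≤ p (star a) := by
  by_contra! h
  have h1 := p.mul_le (star a) a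
  rw [p.star_mul_self] at h1
  have h0 : 0 ≤ p (star a) := p.nonneg _
  nlinarith

lemma star_eq (p : CStarSeminorm F) (a : F) : p (star a) = p a :=
  le_antisymm (by simpa using p.le_star (star a)) (p.le_star a)

instance : Zero (CStarSeminorm F) := ⟨⟨0, fun _ _ => by simp, fun _ => by simp⟩⟩

open Classical in
/-- The pointwise supremum of a pointwise bounded set of C*-seminorms (and `0` if the set is not
pointwise bounded). -/
def sup (S : Set (CStarSeminorm F)) : CStarSeminorm F :=
  if h : ∀ a, BddAbove (Set.range fun p : S => p.1 a) then
    have nn : ∀ a, 0 ≤ ⨆ p : S, p.1 a := fun a => Real.iSup_nonneg fun p => p.1.nonneg a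
    { toSeminorm := Seminorm.of (fun a => ⨆ p : S, p.1 a)
        (fun a b => Real.iSup_le (fun p => (map_add_le_add p.1.toSeminorm a b).trans
          (add_le_add (le_ciSup (h a) p) (le_ciSup (h b) p))) (add_nonneg (nn a) (nn b)))
        (fun c a => by
          simp only [map_smul_eq_mul]
          exact (Real.mul_iSup_of_nonneg (norm_nonneg c) _).symm)
      mul_le := fun a b => Real.iSup_le (fun p => (p.1.mul_le a b).trans
          (mul_le_mul (le_ciSup (h a) p) (le_ciSup (h b) p) (p.1.nonneg _) (nn a)))
          (mul_nonneg (nn a) (nn b))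
      star_mul_self := fun a => by
        apply le_antisymm
        · refine Real.iSup_le (fun p => ?_) (sq_nonneg _)
          rw [p.1.star_mul_self]
          exact pow_le_pow_left₀ (p.1.nonneg _) (le_ciSup (h a) p) 2
        · refine (Real.le_sqrt (nn a) (nn _)).1 (Real.iSup_le (fun p => ?_) (Real.sqrt_nonneg _))
          refine (Real.le_sqrt (p.1.nonneg a) (nn _)).2 ?_
          rw [← p.1.star_mul_self]
          exact le_ciSup (h (star a * a)) p }
  else 0

/-- The *-algebra `F`, regarded as a seminormed algebra via `p`. -/
def Pre (_p : CStarSeminorm F) : Type _ := F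

variable (p : CStarSeminorm F)

instance instRingPre : Ring p.Pre := inferInstanceAs (Ring F)
instance instStarRingPre : StarRing p.Pre := inferInstanceAs (StarRing F)
instance instAlgebraPre : Algebra ℂ p.Pre := inferInstanceAs (Algebra ℂ F)
instance : SeminormedRing p.Pre :=
  { instRingPre p with
    __ := AddGroupSeminorm.toSeminormedAddCommGroup (E := p.Pre) p.toSeminorm.toAddGroupSeminorm
    norm_mul_le := p.mul_le }
instance : NormedAlgebra ℂ p.Pre where
  __ := instAlgebraPre p
  norm_smul_le c a := (map_smul_eq_mul p.toSeminorm c a).le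
instance : NormedStarGroup p.Pre where
  norm_star_le a := (p.star_eq a).le

/-- The Hausdorff completion of `F` with respect to `p`. -/
abbrev Completion : Type _ := UniformSpace.Completion p.Pre

/-- The canonical map from `F` to its completion. -/
def toCompl (a : F) : p.Completion := ((show p.Pre from a : p.Pre) : UniformSpace.Completion p.Pre)

lemma norm_toCompl (a : F) : ‖p.toCompl a‖ = p a :=
  UniformSpace.Completion.norm_coe (E := p.Pre) a

lemma denseRange_toCompl : DenseRange p.toCompl :=
  UniformSpace.Completion.denseRange_coe (α := p.Pre)

lemma toCompl_add (a b : F) : p.toCompl (a + b) = p.toCompl a + p.toCompl b :=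
  UniformSpace.Completion.coe_add (α := p.Pre) a b

lemma toCompl_mul (a b : F) : p.toCompl (a * b) = p.toCompl a * p.toCompl b :=
  UniformSpace.Completion.coe_mul (α := p.Pre) a b

lemma toCompl_smul (c : ℂ) (a : F) : p.toCompl (c • a) = c • p.toCompl a :=
  UniformSpace.Completion.coe_smul (X := p.Pre) c a

instance : NormedAlgebra ℂ p.Completion where
  norm_smul_le := norm_smul_le

instance : Star p.Completion :=
  ⟨UniformSpace.Completion.map (α := p.Pre) (β := p.Pre) star⟩

lemma continuous_star' : Continuous (star : p.Completion → p.Completion) :=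
  UniformSpace.Completion.continuous_map

lemma toCompl_star (a : F) : p.toCompl (star a) = star (p.toCompl a) :=
  (UniformSpace.Completion.map_coe (α := p.Pre) (β := p.Pre)
    (f := star) (starNormedAddGroupHom (E := p.Pre)).uniformContinuous a).symm

instance : StarRing p.Completion where
  star_involutive x := by
    have := p.continuous_star'
    refine p.denseRange_toCompl.induction_on (p := fun x => star (star x) = x) x
      (isClosed_eq (by fun_prop) (by fun_prop)) (fun a => ?_)
    rw [← toCompl_star, ← toCompl_star, star_star]
  star_mul x y := by
    have := p.continuous_star'
    refine p.denseRange_toCompl.induction_on₂ (p := fun x y => star (x * y) = star y * star x)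
      (isClosed_eq (by fun_prop) (by fun_prop)) (fun a b => ?_) x y
    rw [← toCompl_mul, ← toCompl_star, star_mul, toCompl_mul, toCompl_star, toCompl_star]
  star_add x y := by
    have := p.continuous_star'
    refine p.denseRange_toCompl.induction_on₂ (p := fun x y => star (x + y) = star x + star y)
      (isClosed_eq (by fun_prop) (by fun_prop)) (fun a b => ?_) x y
    rw [← toCompl_add, ← toCompl_star, star_add, toCompl_add, toCompl_star, toCompl_star]

variable [StarModule ℂ F]

/-- The completion of a *-algebra with respect to a C*-seminorm is a unital C*-algebra. -/
instance : CStarAlgebra p.Completion where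
  norm_mul_self_le x := by
    have := p.continuous_star'
    refine p.denseRange_toCompl.induction_on (p := fun x => ‖x‖ * ‖x‖ ≤ ‖star x * x‖) x
      (isClosed_le (by fun_prop) (by fun_prop)) (fun a => ?_)
    rw [← toCompl_star, ← toCompl_mul, norm_toCompl, norm_toCompl, p.star_mul_self, sq]
  star_smul c x := by
    have := p.continuous_star'
    refine p.denseRange_toCompl.induction_on (p := fun x => star (c • x) = star c • star x) x
      (isClosed_eq (this.comp (continuous_const_smul c))
        ((continuous_const_smul (star c)).comp this)) (fun a => ?_)
    rw [← toCompl_smul, ← toCompl_star, star_smul, toCompl_smul, toCompl_star]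

/-- The canonical unital *-homomorphism from `F` to its completion. -/
def toComplHom : F →⋆ₐ[ℂ] p.Completion where
  toFun := p.toCompl
  map_one' := UniformSpace.Completion.coe_one (α := p.Pre)
  map_mul' := p.toCompl_mul
  map_zero' := UniformSpace.Completion.coe_zero (α := p.Pre)
  map_add' := p.toCompl_add
  commutes' c := by
    rw [Algebra.algebraMap_eq_smul_one, Algebra.algebraMap_eq_smul_one, toCompl_smul]
    exact congrArg _ (UniformSpace.Completion.coe_one (α := p.Pre))
  map_star' := p.toCompl_star

end Basic

end CStarSeminorm

section MinimalTensorProduct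

variable {A B H K : Type*} [CStarAlgebra A] [CStarAlgebra B]
  [NormedAddCommGroup H] [InnerProductSpace ℂ H] [CompleteSpace H]
  [NormedAddCommGroup K] [InnerProductSpace ℂ K] [CompleteSpace K]

/-- The representation `π ⊗ ρ` of the algebraic tensor product on the pre-Hilbert space
tensor product `H ⊗ K`, with `(π ⊗ ρ) (a ⊗ b) = π a ⊗ ρ b`. -/
def tensorRep (π : A →⋆ₐ[ℂ] (H →L[ℂ] H)) (ρ : B →⋆ₐ[ℂ] (K →L[ℂ] K)) :
    A ⊗[ℂ] B →ₐ[ℂ] ((H ⊗[ℂ] K) →L[ℂ] (H ⊗[ℂ] K)) :=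
  Algebra.TensorProduct.algHomOfLinearMapTensorProduct
    (TensorProduct.lift (LinearMap.mk₂ ℂ (fun a b => TensorProduct.mapL (π a) (ρ b))
      (fun a a' b => by rw [map_add, TensorProduct.mapL_add_left])
      (fun c a b => by rw [map_smul, TensorProduct.mapL_smul_left])
      (fun a b b' => by rw [map_add, TensorProduct.mapL_add_right])
      (fun c a b => by rw [map_smul, TensorProduct.mapL_smul_right])))
    (fun a a' b b' => by simp [TensorProduct.mapL_mul])
    (by simp [ContinuousLinearMap.one_def])

lemma tensorRep_tmul (π : A →⋆ₐ[ℂ] (H →L[ℂ] H)) (ρ : B →⋆ₐ[ℂ] (K →L[ℂ] K)) (a : A) (b : B) :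
    tensorRep π ρ (a ⊗ₜ b) = TensorProduct.mapL (π a) (ρ b) := rfl

lemma inner_tensorRep (π : A →⋆ₐ[ℂ] (H →L[ℂ] H)) (ρ : B →⋆ₐ[ℂ] (K →L[ℂ] K)) (x : A ⊗[ℂ] B)
    (ξ η : H ⊗[ℂ] K) :
    inner ℂ (tensorRep π ρ x ξ) η = inner ℂ ξ (tensorRep π ρ (star x) η) := by
  induction x with
  | zero => simp
  | add x y hx hy => simp [inner_add_left, inner_add_right, hx, hy]
  | tmul a b =>
    induction ξ with
    | zero => simp
    | add ξ ξ' h h' => simp only [map_add, inner_add_left, h, h']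
    | tmul h k =>
      induction η with
      | zero => simp
      | add ξ ξ' h h' => simp only [map_add, inner_add_right, h, h']
      | tmul h' k' =>
        rw [TensorProduct.star_tmul, tensorRep_tmul, tensorRep_tmul, TensorProduct.mapL_tmul,
          TensorProduct.mapL_tmul, TensorProduct.inner_tmul, TensorProduct.inner_tmul,
          map_star, map_star, ContinuousLinearMap.star_eq_adjoint,
          ContinuousLinearMap.star_eq_adjoint, ContinuousLinearMap.adjoint_inner_right,
          ContinuousLinearMap.adjoint_inner_right]

/-- The C*-seminorm `x ↦ ‖(π ⊗ ρ) x‖` on the algebraic tensor product. -/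
def tensorRepSeminorm (π : A →⋆ₐ[ℂ] (H →L[ℂ] H)) (ρ : B →⋆ₐ[ℂ] (K →L[ℂ] K)) :
    CStarSeminorm (A ⊗[ℂ] B) where
  toSeminorm := (normSeminorm ℂ ((H ⊗[ℂ] K) →L[ℂ] (H ⊗[ℂ] K))).comp (tensorRep π ρ).toLinearMap
  mul_le x y := by
    simpa using norm_mul_le (tensorRep π ρ x) (tensorRep π ρ y)
  star_mul_self x := by
    have key : ∀ y, ‖tensorRep π ρ y‖ ^ 2 ≤ ‖tensorRep π ρ (star y * y)‖ := fun y => by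
      refine (Real.le_sqrt (norm_nonneg (tensorRep π ρ y))
        (norm_nonneg (tensorRep π ρ (star y * y)))).1
        ((tensorRep π ρ y).opNorm_le_bound (Real.sqrt_nonneg _) fun ξ => ?_)
      refine (sq_le_sq₀ (norm_nonneg _) (by positivity)).1 ?_
      rw [mul_pow, Real.sq_sqrt (norm_nonneg _), ← inner_self_eq_norm_sq (𝕜 := ℂ),
        inner_tensorRep]
      rw [← mul_apply_eq_comp, ← map_mul]
      refine (RCLike.re_le_norm _).trans ((norm_inner_le_norm (𝕜 := ℂ) ξ (tensorRep π ρ (star y * y) ξ)).trans ?_)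
      nlinarith [(tensorRep π ρ (star y * y)).le_opNorm ξ, norm_nonneg ξ]
    have hm : ∀ y, ‖tensorRep π ρ (star y * y)‖ ≤ ‖tensorRep π ρ (star y)‖ * ‖tensorRep π ρ y‖ :=
      fun y => by rw [map_mul]; exact norm_mul_le (tensorRep π ρ (star y)) (tensorRep π ρ y)
    have hs : ∀ y, ‖tensorRep π ρ y‖ ≤ ‖tensorRep π ρ (star y)‖ := fun y => by
      by_contra! h
      nlinarith [key y, hm y, norm_nonneg (tensorRep π ρ (star y))]
    have he : ‖tensorRep π ρ (star x)‖ = ‖tensorRep π ρ x‖ :=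
      le_antisymm (by simpa using hs (star x)) (hs x)
    have h2 := hm x
    rw [he, ← sq] at h2
    exact le_antisymm h2 (key x)

end MinimalTensorProduct

/-- The minimal (spatial) C*-norm on the algebraic tensor product: the supremum of
`‖(π ⊗ ρ) x‖` over all representations `π` of `A` and `ρ` of `B` on Hilbert spaces. Hilbert spaces
in the universes of `A` and `B` suffice, since `A` and `B` have faithful representations there. -/
def minTensorSeminorm (A : Type u) (B : Type v) [CStarAlgebra A] [CStarAlgebra B] :
    CStarSeminorm (A ⊗[ℂ] B) :=
  CStarSeminorm.sup {q | ∃ (H : Type u) (_ : NormedAddCommGroup H) (_ : InnerProductSpace ℂ H)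
    (_ : CompleteSpace H) (K : Type v) (_ : NormedAddCommGroup K) (_ : InnerProductSpace ℂ K)
    (_ : CompleteSpace K) (π : A →⋆ₐ[ℂ] (H →L[ℂ] H)) (ρ : B →⋆ₐ[ℂ] (K →L[ℂ] K)),
    q = tensorRepSeminorm π ρ}

/-- The set of seminorms in the definition of the minimal C*-norm is pointwise bounded. -/
lemma minTensorSeminorm_bddAbove (A : Type u) (B : Type v) [CStarAlgebra A] [CStarAlgebra B]
    (x : A ⊗[ℂ] B) : ∃ C : ℝ, ∀ (H : Type u) [NormedAddCommGroup H] [InnerProductSpace ℂ H]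
    [CompleteSpace H] (K : Type v) [NormedAddCommGroup K] [InnerProductSpace ℂ K]
    [CompleteSpace K] (π : A →⋆ₐ[ℂ] (H →L[ℂ] H)) (ρ : B →⋆ₐ[ℂ] (K →L[ℂ] K)),
    tensorRepSeminorm π ρ x ≤ C := by
  induction x with
  | zero => exact ⟨0, fun H _ _ _ K _ _ _ π ρ => (map_zero (tensorRepSeminorm π ρ).toSeminorm).le⟩
  | add x y hx hy =>
    obtain ⟨C, hC⟩ := hx
    obtain ⟨D, hD⟩ := hy
    exact ⟨C + D, fun H _ _ _ K _ _ _ π ρ =>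
      (map_add_le_add (tensorRepSeminorm π ρ).toSeminorm x y).trans
        (add_le_add (hC H K π ρ) (hD H K π ρ))⟩
  | tmul a b =>
    refine ⟨‖a‖ * ‖b‖, fun H _ _ _ K _ _ _ π ρ => (TensorProduct.norm_mapL_le (π a) (ρ b)).trans ?_⟩
    exact mul_le_mul (NonUnitalStarAlgHom.norm_apply_le π a)
      (NonUnitalStarAlgHom.norm_apply_le ρ b) (norm_nonneg _) (norm_nonneg _)

/-- The minimal tensor product of two unital C*-algebras. -/
abbrev MinTensor (A : Type u) (B : Type v) [CStarAlgebra A] [CStarAlgebra B] : Type (max u v) :=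
  (minTensorSeminorm A B).Completion

/-- The elementary tensor `a ⊗ b` in the minimal tensor product. -/
def minTmul {A : Type u} {B : Type v} [CStarAlgebra A] [CStarAlgebra B] (a : A) (b : B) :
    MinTensor A B :=
  (minTensorSeminorm A B).toComplHom (a ⊗ₜ[ℂ] b)

/-- The free unital complex *-algebra on a set `X` of generators: the algebra of words in the
letters `(g, false)`, representing the generator `g`, and `(g, true)`, representing `g*`. -/
def FreeStarAlg (X : Type u) : Type u := MonoidAlgebra ℂ (FreeMonoid (X × Bool))

namespace FreeStarAlg

variable {X : Type u}

instance : Ring (FreeStarAlg X) := inferInstanceAs (Ring (MonoidAlgebra ℂ (FreeMonoid (X × Bool))))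
instance : Algebra ℂ (FreeStarAlg X) :=
  inferInstanceAs (Algebra ℂ (MonoidAlgebra ℂ (FreeMonoid (X × Bool))))

/-- The adjoint of a word: reverse it and take the adjoint of each letter. -/
def wordStar (w : FreeMonoid (X × Bool)) : FreeMonoid (X × Bool) :=
  star (FreeMonoid.map (fun a => (a.1, !a.2)) w)

lemma wordStar_wordStar (w : FreeMonoid (X × Bool)) : wordStar (wordStar w) = w := by
  induction w using FreeMonoid.inductionOn' with
  | one => rfl
  | of_mul a w ih => simp_all [wordStar]

lemma wordStar_mul (w w' : FreeMonoid (X × Bool)) :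
    wordStar (w * w') = wordStar w' * wordStar w := by
  simp [wordStar]

/-- The monomial `c • w`. -/
def mon (w : FreeMonoid (X × Bool)) (c : ℂ) : FreeStarAlg X := MonoidAlgebra.single w c

lemma mon_mul (w w' : FreeMonoid (X × Bool)) (c c' : ℂ) :
    mon w c * mon w' c' = mon (w * w') (c * c') :=
  MonoidAlgebra.single_mul_single w w' c c'

lemma smul_mon (w : FreeMonoid (X × Bool)) (c c' : ℂ) : c • mon w c' = mon w (c * c') :=
  MonoidAlgebra.smul_single c w c'

lemma induction_mon {P : FreeStarAlg X → Prop} (f : FreeStarAlg X) (zero : P 0)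
    (add : ∀ f g, P f → P g → P (f + g)) (mon : ∀ w c, P (mon w c)) : P f :=
  MonoidAlgebra.induction_linear (R := ℂ) (M := FreeMonoid (X × Bool)) f zero add mon

/-- The involution, sending `c • w` to `conj c • w*`. -/
instance : Star (FreeStarAlg X) :=
  ⟨fun f => MonoidAlgebra.mapDomain (R := ℂ) wordStar
    (MonoidAlgebra.mapRingHom (FreeMonoid (X × Bool)) (starRingEnd ℂ) f)⟩

lemma star_zero' : star (0 : FreeStarAlg X) = 0 :=
  (congrArg (MonoidAlgebra.mapDomain (R := ℂ) wordStar)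
    (map_zero (MonoidAlgebra.mapRingHom (FreeMonoid (X × Bool)) (starRingEnd ℂ)))).trans
    (MonoidAlgebra.mapDomain_zero _)

lemma star_add' (f g : FreeStarAlg X) : star (f + g) = star f + star g :=
  (congrArg (MonoidAlgebra.mapDomain (R := ℂ) wordStar)
    (map_add (MonoidAlgebra.mapRingHom (FreeMonoid (X × Bool)) (starRingEnd ℂ)) f g)).trans
    (MonoidAlgebra.mapDomain_add _ _ _)

lemma star_mon (w : FreeMonoid (X × Bool)) (c : ℂ) :
    star (mon w c) = mon (wordStar w) (star c) :=
  (congrArg (MonoidAlgebra.mapDomain (R := ℂ) wordStar)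
    (MonoidAlgebra.mapRingHom_single (starRingEnd ℂ) w c)).trans
    MonoidAlgebra.mapDomain_single

instance : StarRing (FreeStarAlg X) where
  star_involutive f := by
    induction f using induction_mon with
    | zero => rw [star_zero', star_zero']
    | add f g hf hg => rw [star_add', star_add', hf, hg]
    | mon w c => rw [star_mon, star_mon, wordStar_wordStar, star_star]
  star_mul f g := by
    induction f using induction_mon with
    | zero => rw [zero_mul, star_zero', mul_zero]
    | add f f' hf hf' => rw [add_mul, star_add', star_add', hf, hf', mul_add]
    | mon w c =>
      induction g using induction_mon with
      | zero => rw [mul_zero, star_zero', zero_mul]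
      | add f f' hf hf' => rw [mul_add, star_add', star_add', hf, hf', add_mul]
      | mon w' c' => rw [mon_mul, star_mon, star_mon, star_mon, mon_mul, wordStar_mul, star_mul]
  star_add := star_add'

instance : StarModule ℂ (FreeStarAlg X) where
  star_smul c f := by
    induction f using induction_mon with
    | zero => simp
    | add f g hf hg => rw [smul_add, star_add, hf, hg, star_add, smul_add]
    | mon w c' => rw [smul_mon, star_mon, star_mon, smul_mon, star_mul']

/-- The generator `g` of the free *-algebra. -/
def gen (g : X) : FreeStarAlg X := mon (FreeMonoid.of (g, false)) 1

end FreeStarAlg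

/-- The universal C*-seminorm for generators `X` and relations `R` (a pair `(a, b)` standing for
the relation `a = b`): the supremum of all C*-seminorms on the free *-algebra for which the
relations hold. -/
def univSeminorm {X : Type u} (R : Set (FreeStarAlg X × FreeStarAlg X)) :
    CStarSeminorm (FreeStarAlg X) :=
  CStarSeminorm.sup {p | ∀ r ∈ R, p (r.1 - r.2) = 0}

/-- The universal unital C*-algebra `C*(X | R)`. It exists if the C*-seminorms for which the
relations hold are pointwise bounded. -/
abbrev UnivCStar {X : Type u} (R : Set (FreeStarAlg X × FreeStarAlg X)) : Type u :=
  (univSeminorm R).Completion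

/-- The generator `g` of the universal C*-algebra. -/
def UnivCStar.gen {X : Type u} (R : Set (FreeStarAlg X × FreeStarAlg X)) (g : X) : UnivCStar R :=
  (univSeminorm R).toComplHom (FreeStarAlg.gen g)

/-! ### Two-coloured partitions -/

/-- The colours of points; white corresponds to the exponent `1` and black to `*`. -/
inductive Color where
  | white
  | black

/-- `a ^ ω` for `ω ∈ {1, *}`. -/
def Color.act {A : Type*} [Star A] : Color → A → A
  | white, a => a
  | black, a => star a

/-- A two-coloured partition with `k` upper and `l` lower points. The blocks are the equivalence
classes of `rel`. -/
structure ColPartition where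
  k : ℕ
  l : ℕ
  upper : Fin k → Color
  lower : Fin l → Color
  rel : Setoid (Fin k ⊕ Fin l)

namespace ColPartition

/-- The partition with two lower points of colours `a`, `b` in one block. -/
def lowerPair (a b : Color) : ColPartition := ⟨0, 2, ![], ![a, b], ⊤⟩

/-- The partition with two upper points of colours `a`, `b` in one block. -/
def upperPair (a b : Color) : ColPartition := ⟨2, 0, ![a, b], ![], ⊤⟩

/-- The four mixed-coloured pair partitions. -/
def mixedPairs : Set ColPartition :=
  {lowerPair .white .black, lowerPair .black .white,
    upperPair .white .black, upperPair .black .white}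

variable (p : ColPartition)

/-- The through-blocks: the blocks that contain both upper and lower points. -/
def ThroughBlock : Type :=
  {b : Quotient p.rel // (∃ s, Quotient.mk p.rel (Sum.inl s) = b) ∧
    ∃ s, Quotient.mk p.rel (Sum.inr s) = b}

/-- Valid labelings of the upper row: connected points have equal labels. -/
def ValidUpper {N : ℕ} (t : Fin p.k → Fin N) : Prop :=
  ∀ s s', p.rel (Sum.inl s) (Sum.inl s') → t s = t s'

/-- Valid labelings of the lower row: connected points have equal labels. -/
def ValidLower {N : ℕ} (t : Fin p.l → Fin N) : Prop :=
  ∀ s s', p.rel (Sum.inr s) (Sum.inr s') → t s = t s'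

open Classical in
/-- The sets `T_i`, `1 ≤ i ≤ r = N ^ tb(p)`, indexed by the labelings `i` of the through-blocks:
all valid labelings of the upper row that restrict to `i` on the through-blocks. -/
def T {N : ℕ} (i : p.ThroughBlock → Fin N) : Finset (Fin p.k → Fin N) :=
  {t | p.ValidUpper t ∧
    ∀ (b : p.ThroughBlock) (s : Fin p.k), Quotient.mk p.rel (Sum.inl s) = b.1 → t s = i b}

open Classical in
/-- The sets `T'_i`: all valid labelings of the lower row that restrict to `i` on the
through-blocks. -/
def T' {N : ℕ} (i : p.ThroughBlock → Fin N) : Finset (Fin p.l → Fin N) :=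
  {t | p.ValidLower t ∧
    ∀ (b : p.ThroughBlock) (s : Fin p.l), Quotient.mk p.rel (Sum.inr s) = b.1 → t s = i b}

variable {p}

lemma mem_T {N : ℕ} (i : p.ThroughBlock → Fin N) {t : Fin p.k → Fin N} :
    t ∈ p.T i ↔ p.ValidUpper t ∧ ∀ (b : p.ThroughBlock) (s : Fin p.k),
      Quotient.mk p.rel (Sum.inl s) = b.1 → t s = i b := by
  simp [T]

lemma mem_T' {N : ℕ} (i : p.ThroughBlock → Fin N) {t : Fin p.l → Fin N} :
    t ∈ p.T' i ↔ p.ValidLower t ∧ ∀ (b : p.ThroughBlock) (s : Fin p.l),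
      Quotient.mk p.rel (Sum.inr s) = b.1 → t s = i b := by
  simp [T']

end ColPartition

/-- The product `y_{s₁ t₁}^{ω₁} ⋯ y_{sₙ tₙ}^{ωₙ}`; it is `1` for `n = 0`. -/
def wordProd {A : Type*} [Ring A] [Star A] {N d n : ℕ} (y : Fin N → Fin d → A)
    (ω : Fin n → Color) (s : Fin n → Fin N) (t : Fin n → Fin d) : A :=
  (List.ofFn fun a => (ω a).act (y (s a) (t a))).prod

/-- The quantum group relations `R^Gr_p(u)`; a pair `(a, b)` stands for the relation `a = b`. -/
inductive GrRel {A : Type*} [Ring A] [Star A] {N : ℕ} (p : ColPartition) (u : Fin N → Fin N → A) :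
    A × A → Prop
  | both (i j : p.ThroughBlock → Fin N) (γ : Fin p.k → Fin N) (γ' : Fin p.l → Fin N)
      (hγ : γ ∈ p.T j) (hγ' : γ' ∈ p.T' i) :
      GrRel p u (∑ t ∈ p.T i, wordProd u p.upper t γ, ∑ t' ∈ p.T' j, wordProd u p.lower γ' t')
  | upper (i : p.ThroughBlock → Fin N) (γ : Fin p.k → Fin N) (hγ : ¬ p.ValidUpper γ) :
      GrRel p u (∑ t ∈ p.T i, wordProd u p.upper t γ, 0)
  | lower (j : p.ThroughBlock → Fin N) (γ' : Fin p.l → Fin N) (hγ' : ¬ p.ValidLower γ') :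
      GrRel p u (∑ t' ∈ p.T' j, wordProd u p.lower γ' t', 0)

/-- The quantum space relations `R^Sp_p(x)` for a `d`-tuple `x = (x_{ij})` of vectors; a pair
`(a, b)` stands for the relation `a = b`. The column indices in `[d]` are regarded as elements of
`[N]` via `d ≤ N`. -/
inductive SpRel {A : Type*} [Ring A] [Star A] {N d : ℕ} (h : d ≤ N) (p : ColPartition)
    (x : Fin N → Fin d → A) : A × A → Prop
  | both (i j : p.ThroughBlock → Fin N) (γ : Fin p.k → Fin d) (γ' : Fin p.l → Fin d)
      (hγ : Fin.castLE h ∘ γ ∈ p.T j) (hγ' : Fin.castLE h ∘ γ' ∈ p.T' j) :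
      SpRel h p x
        (∑ t ∈ p.T i, wordProd x p.upper t γ, ∑ t' ∈ p.T' i, wordProd x p.lower t' γ')
  | upper (i : p.ThroughBlock → Fin N) (γ : Fin p.k → Fin d)
      (hγ : ¬ p.ValidUpper (Fin.castLE h ∘ γ)) :
      SpRel h p x (∑ t ∈ p.T i, wordProd x p.upper t γ, 0)
  | lower (i : p.ThroughBlock → Fin N) (γ' : Fin p.l → Fin d)
      (hγ' : ¬ p.ValidLower (Fin.castLE h ∘ γ')) :
      SpRel h p x (∑ t' ∈ p.T' i, wordProd x p.lower t' γ', 0)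

/-- The relations `R^Gr_p(u)`, `p ∈ Π`, for the generators `u_{ij}`. -/
def easyRelations (N : ℕ) (P : Set ColPartition) :
    Set (FreeStarAlg (Fin N × Fin N) × FreeStarAlg (Fin N × Fin N)) :=
  {r | ∃ p ∈ P, GrRel p (fun i j => FreeStarAlg.gen (i, j)) r}

/-- `C(G_N(Π))`, the universal C*-algebra of the easy quantum group. -/
abbrev EasyQG (N : ℕ) (P : Set ColPartition) : Type := UnivCStar (easyRelations N P)

/-- The matrix of generators of `C(G_N(Π))`. -/
def EasyQG.u (N : ℕ) (P : Set ColPartition) : Matrix (Fin N) (Fin N) (EasyQG N P) :=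
  fun i j => UnivCStar.gen (easyRelations N P) (i, j)

/-- The relations `R^Sp_p(x)`, `p ∈ Π`, for the generators `x_{ij}`. -/
def pqsRelations {N d : ℕ} (h : d ≤ N) (P : Set ColPartition) :
    Set (FreeStarAlg (Fin N × Fin d) × FreeStarAlg (Fin N × Fin d)) :=
  {r | ∃ p ∈ P, SpRel h p (fun i j => FreeStarAlg.gen (i, j)) r}

/-- `C(X_{N,d}(Π))`, the universal C*-algebra of the partition quantum space of `d` vectors. -/
abbrev PQS {N d : ℕ} (h : d ≤ N) (P : Set ColPartition) : Type := UnivCStar (pqsRelations h P)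

/-- The `d` vectors of generators of `C(X_{N,d}(Π))`. -/
def PQS.x {N d : ℕ} (h : d ≤ N) (P : Set ColPartition) : Matrix (Fin N) (Fin d) (PQS h P) :=
  fun i j => UnivCStar.gen (pqsRelations h P) (i, j)

/-! ### Existence of the universal C*-algebras -/

lemma norm_le_one_of_sum {A : Type*} [CStarAlgebra A] {ι : Type*} [Fintype ι] (a : ι → A)
    (h : ∑ i, a i * star (a i) = 1) (i : ι) : ‖a i‖ ≤ 1 := by
  let _ := CStarAlgebra.spectralOrder A
  have := CStarAlgebra.spectralOrderedRing A
  rcases subsingleton_or_nontrivial A with hA | hA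
  · simp [Subsingleton.elim (a i) 0]
  have h1 : a i * star (a i) ≤ 1 := by
    rw [← h]
    exact Finset.single_le_sum (f := fun i => a i * star (a i))
      (fun j _ => mul_star_self_nonneg (a j)) (Finset.mem_univ i)
  have h2 := CStarAlgebra.norm_le_norm_of_nonneg_of_le (mul_star_self_nonneg (a i)) h1
  rw [CStarRing.norm_self_mul_star, norm_one] at h2
  nlinarith [norm_nonneg (a i)]

lemma CStarSeminorm.sum_eq_one {F : Type*} [Ring F] [StarRing F] [Algebra ℂ F] [StarModule ℂ F]
    (p : CStarSeminorm F) {ι : Type*} [Fintype ι] (a : ι → F)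
    (h : p (1 - ∑ i, a i * star (a i)) = 0) :
    ∑ i, p.toComplHom (a i) * star (p.toComplHom (a i)) = 1 := by
  rw [← p.norm_toCompl, norm_eq_zero] at h
  change p.toComplHom _ = 0 at h
  rw [map_sub, sub_eq_zero, map_one, map_sum] at h
  rw [h]
  simp [map_mul, map_star]

lemma FreeStarAlg.star_gen {X : Type u} (g : X) :
    star (gen g) = mon (FreeMonoid.of (g, true)) 1 := by
  simp [gen, star_mon, wordStar]

/-- A family of C*-seminorms on the free *-algebra that is bounded on the generators is pointwise
bounded. -/
lemma FreeStarAlg.bddAbove {X : Type u} (S : Set (CStarSeminorm (FreeStarAlg X)))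
    (h : ∀ p ∈ S, ∀ g, p (gen g) ≤ 1) (f : FreeStarAlg X) :
    BddAbove (Set.range fun p : S => p.1 f) := by
  suffices H : ∃ C, ∀ p ∈ S, p f ≤ C by
    obtain ⟨C, hC⟩ := H
    exact ⟨C, by rintro _ ⟨p, rfl⟩; exact hC p.1 p.2⟩
  induction f using induction_mon with
  | zero => exact ⟨0, fun p _ => (map_zero p.toSeminorm).le⟩
  | add f g hf hg =>
    obtain ⟨C, hC⟩ := hf
    obtain ⟨D, hD⟩ := hg
    exact ⟨C + D, fun p hp => (map_add_le_add p.toSeminorm f g).trans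
      (add_le_add (hC p hp) (hD p hp))⟩
  | mon w c =>
    refine ⟨‖c‖, fun p hp => ?_⟩
    have hw : p (mon w 1) ≤ 1 := by
      induction w using FreeMonoid.inductionOn' with
      | one =>
        have : p (mon 1 1 : FreeStarAlg X) = p (mon 1 1 : FreeStarAlg X) ^ 2 := by
          rw [← p.star_mul_self, star_mon, mon_mul]; simp [wordStar]
        nlinarith [p.nonneg (mon 1 1 : FreeStarAlg X)]
      | of_mul a w ih =>
        have e : mon (FreeMonoid.of a * w) 1 = mon (FreeMonoid.of a) 1 * mon w 1 := by
          rw [mon_mul, one_mul]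
        have ha : p (mon (FreeMonoid.of a) 1) ≤ 1 := by
          obtain ⟨g, b⟩ := a
          cases b
          · exact h p hp g
          · rw [← star_gen, p.star_eq]; exact h p hp g
        rw [e]
        exact (p.mul_le _ _).trans (mul_le_one₀ ha (p.nonneg _) ih)
    have e : mon w c = c • mon w 1 := by rw [smul_mon, mul_one]
    rw [e, map_smul_eq_mul]
    exact mul_le_of_le_one_right (norm_nonneg c) hw

namespace ColPartition

lemma lowerPair_throughBlock {a b : Color} (x : (lowerPair a b).ThroughBlock) : False :=
  Fin.elim0 x.2.1.choose

lemma mem_T_lowerPair {N : ℕ} {a b : Color} (i : (lowerPair a b).ThroughBlock → Fin N)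
    (t : Fin (lowerPair a b).k → Fin N) : t ∈ (lowerPair a b).T i :=
  (mem_T _).2 ⟨fun s => Fin.elim0 s, fun x => (lowerPair_throughBlock x).elim⟩

lemma const_mem_T'_lowerPair {N : ℕ} {a b : Color} (i : (lowerPair a b).ThroughBlock → Fin N)
    (s : Fin N) : (fun _ => s) ∈ (lowerPair a b).T' i :=
  (mem_T' _).2 ⟨fun _ _ _ => rfl, fun x => (lowerPair_throughBlock x).elim⟩

lemma sum_T'_lowerPair {N : ℕ} {M : Type*} [AddCommMonoid M] {a b : Color}
    (i : (lowerPair a b).ThroughBlock → Fin N) (f : (Fin (lowerPair a b).l → Fin N) → M) :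
    ∑ t ∈ (lowerPair a b).T' i, f t = ∑ s : Fin N, f (fun _ => s) := by
  symm
  refine Finset.sum_bij (fun s _ => fun _ => s) (fun s _ => const_mem_T'_lowerPair i s)
    (fun s _ s' _ h => congrFun h (0 : Fin 2)) (fun t ht => ?_) (fun _ _ => rfl)
  refine ⟨t (0 : Fin 2), Finset.mem_univ _, ?_⟩
  funext s
  exact ((mem_T' _).1 ht).1 (0 : Fin 2) s trivial

lemma sum_T_lowerPair {N : ℕ} {M : Type*} [AddCommMonoid M] {a b : Color}
    (i : (lowerPair a b).ThroughBlock → Fin N) (f : (Fin (lowerPair a b).k → Fin N) → M) :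
    ∑ t ∈ (lowerPair a b).T i, f t = f (fun s => Fin.elim0 s) := by
  rw [Finset.sum_eq_single_of_mem _ (mem_T_lowerPair i _)]
  intro t _ ht
  exact (ht (funext fun s => Fin.elim0 s)).elim

end ColPartition

/-- The C*-seminorms on the free *-algebra for which the quantum space relations hold are
pointwise bounded, so that the universal C*-algebra `C(X_{N,d}(Π))` exists. -/
lemma pqs_bddAbove {N d : ℕ} (h : d ≤ N) (P : Set ColPartition)
    (hP : ColPartition.mixedPairs ⊆ P) (f : FreeStarAlg (Fin N × Fin d)) :
    BddAbove (Set.range fun p : {p : CStarSeminorm (FreeStarAlg (Fin N × Fin d)) |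
      ∀ r ∈ pqsRelations h P, p (r.1 - r.2) = 0} => p.1 f) := by
  refine FreeStarAlg.bddAbove _ (fun p hp g => ?_) f
  obtain ⟨i, j⟩ := g
  have hr := hp _ ⟨ColPartition.lowerPair .white .black, hP (by simp [ColPartition.mixedPairs]),
    SpRel.both (fun x => (ColPartition.lowerPair_throughBlock x).elim)
      (fun x => (ColPartition.lowerPair_throughBlock x).elim) (fun s => Fin.elim0 s) (fun _ => j)
      (ColPartition.mem_T_lowerPair _ _) (ColPartition.const_mem_T'_lowerPair _ _)⟩
  rw [ColPartition.sum_T'_lowerPair, ColPartition.sum_T_lowerPair] at hr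
  rw [← p.norm_toCompl]
  refine norm_le_one_of_sum (fun s => p.toComplHom (FreeStarAlg.gen (s, j))) ?_ i
  exact p.sum_eq_one (fun s => FreeStarAlg.gen (s, j)) (by
    simpa [wordProd, ColPartition.lowerPair, Color.act, List.ofFn_succ] using hr)

/-- The C*-seminorms on the free *-algebra for which the quantum group relations hold are
pointwise bounded, so that the universal C*-algebra `C(G_N(Π))` exists. -/
lemma easy_bddAbove (N : ℕ) (P : Set ColPartition)
    (hP : ColPartition.mixedPairs ⊆ P) (f : FreeStarAlg (Fin N × Fin N)) :
    BddAbove (Set.range fun p : {p : CStarSeminorm (FreeStarAlg (Fin N × Fin N)) |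
      ∀ r ∈ easyRelations N P, p (r.1 - r.2) = 0} => p.1 f) := by
  refine FreeStarAlg.bddAbove _ (fun p hp g => ?_) f
  obtain ⟨i, j⟩ := g
  have hr := hp _ ⟨ColPartition.lowerPair .white .black, hP (by simp [ColPartition.mixedPairs]),
    GrRel.both (fun x => (ColPartition.lowerPair_throughBlock x).elim)
      (fun x => (ColPartition.lowerPair_throughBlock x).elim) (fun s => Fin.elim0 s) (fun _ => i)
      (ColPartition.mem_T_lowerPair _ _) (ColPartition.const_mem_T'_lowerPair _ _)⟩
  rw [ColPartition.sum_T'_lowerPair, ColPartition.sum_T_lowerPair] at hr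
  rw [← p.norm_toCompl]
  refine norm_le_one_of_sum (fun s => p.toComplHom (FreeStarAlg.gen (i, s))) ?_ j
  exact p.sum_eq_one (fun s => FreeStarAlg.gen (i, s)) (by
    simpa [wordProd, ColPartition.lowerPair, Color.act, List.ofFn_succ] using hr)

/-! ### Compact matrix quantum groups and their actions -/

/-- `u` is the fundamental matrix of a compact matrix quantum group `G` with `C(G) = A`. -/
structure IsCMQG {A : Type u} [CStarAlgebra A] {N : ℕ} (u : Matrix (Fin N) (Fin N) A) : Prop where
  generates : (StarAlgebra.adjoin ℂ {a : A | ∃ i j, a = u i j}).topologicalClosure = ⊤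
  isUnit : IsUnit u
  isUnit_conj : IsUnit (u.map star)
  comul : ∃ Δ : A →⋆ₐ[ℂ] MinTensor A A, ∀ i j, Δ (u i j) = ∑ k, minTmul (u i k) (u k j)

/-- The existence of a left matrix-vector action
`α(x_{ij}) = ∑ₖ u_{ik} ⊗ x_{kj}`. -/
def HasLeftAction {A : Type u} {B : Type v} [CStarAlgebra A] [CStarAlgebra B] {N d : ℕ}
    (u : Matrix (Fin N) (Fin N) A) (x : Matrix (Fin N) (Fin d) B) : Prop :=
  ∃ α : B →⋆ₐ[ℂ] MinTensor A B, ∀ i j, α (x i j) = ∑ k, minTmul (u i k) (x k j)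

/-- The existence of a right matrix-vector action
`β(x_{ij}) = ∑ₖ u_{ki} ⊗ x_{kj}`. -/
def HasRightAction {A : Type u} {B : Type v} [CStarAlgebra A] [CStarAlgebra B] {N d : ℕ}
    (u : Matrix (Fin N) (Fin N) A) (x : Matrix (Fin N) (Fin d) B) : Prop :=
  ∃ β : B →⋆ₐ[ℂ] MinTensor A B, ∀ i j, β (x i j) = ∑ k, minTmul (u k i) (x k j)

/-- The compact matrix quantum group with fundamental matrix `u` is the quantum symmetry group
of the quantum space with vectors of generators `x`: it acts from the left and from the right,
and it contains every compact matrix quantum group `G'` (with `C(G')` in the universe `w`) that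
does so, i.e. there is a *-homomorphism `C(G) → C(G')` mapping the fundamental matrix of `G`
entrywise to that of `G'`. -/
structure IsQuantumSymmetryGroup {A : Type u} {B : Type v} [CStarAlgebra A] [CStarAlgebra B]
    {N d : ℕ} (u : Matrix (Fin N) (Fin N) A) (x : Matrix (Fin N) (Fin d) B) : Prop where
  isCMQG : IsCMQG u
  left : HasLeftAction u x
  right : HasRightAction u x
  maximal : ∀ (A' : Type w) [CStarAlgebra A'] (v : Matrix (Fin N) (Fin N) A'),
    IsCMQG v → HasLeftAction v x → HasRightAction v x →
      ∃ φ : A →⋆ₐ[ℂ] A', ∀ i j, φ (u i j) = v i j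

end

/-!
Let `K` and `K'` be the 0/1 incidence matrices of the families `(T_i)` and `(T'_i)`, and let `X` and
`X'` be the matrices of all words `y^ω_{s,t}` and `y^{ω'}_{s,t}` in the entries of `y`. Grouping the
labelings by the `T_i` turns `R^Gr_p(y)` into the existence of a matrix `Z` with `K X = Z K` and
`X' K'ᵀ = K'ᵀ Z`, and `R^Sp_p(y)` into the existence of `Z` with `K X = Z K` and `K' X' = Z K'`. In
this form the relations pass to products `(∑ₖ a_{ik} b_{kj})` with commuting factors, such as
`∑ₖ u_{ik} ⊗ x_{kj}`.

The sets `T_i` are disjoint and equinumerous, so `K Kᵀ` is a nonzero multiple of `1` and `Z` is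
determined by `X`. The pair partitions make `u` and `ū`, hence all word matrices and then `Z`,
unitary. Taking adjoints therefore shows that `u` and `uᵀ` satisfy `R^Sp_p`, which yields both
actions. Conversely, slicing the two actions of `G'` with the character `x_{ij} ↦ δ_{ij}` gives
`R^Sp_p(v')` and `R^Sp_p(v'ᵀ)`, which together imply `R^Gr_p(v')`. So `C(G_N(Π))` maps to `C(G')`,
and maximality in both directions gives mutually inverse *-homomorphisms.
-/

noncomputable section

section FaithfulRepresentations

open scoped ComplexOrder ComplexStarModule

variable {A : Type*} [CStarAlgebra A] [PartialOrder A] [StarOrderedRing A]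

lemma norm_one_add_of_nonneg {a : A} (ha : 0 ≤ a) : ‖1 + a‖ = ‖(1 : A)‖ + ‖a‖ := by
  refine (norm_add_le 1 a).antisymm ?_
  nontriviality A
  have hmem : ‖(1 : A)‖ + ‖a‖ ∈ spectrum ℝ (1 + a) := by
    simpa [add_comm] using (spectrum.add_mem_add_iff (s := (1 : ℝ))).2
      (CStarAlgebra.norm_mem_spectrum_of_nonneg ha)
  exact (le_abs_self _).trans (spectrum.norm_le_norm_of_mem hmem)

lemma apply_nonneg_of_norm_le_one {g : StrongDual ℝ A} (hg : ‖g‖ ≤ 1) (h1 : g 1 = ‖(1 : A)‖)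
    {a : A} (ha : 0 ≤ a) : 0 ≤ g a := by
  have hle : a ≤ algebraMap ℝ A ‖a‖ := (IsSelfAdjoint.of_nonneg ha).le_algebraMap_norm_self
  have hnorm : ‖algebraMap ℝ A ‖a‖ - a‖ ≤ ‖a‖ * ‖(1 : A)‖ :=
    (CStarAlgebra.norm_le_norm_of_nonneg_of_le (sub_nonneg.2 hle) (sub_le_self _ ha)).trans
      (by simp [norm_algebraMap])
  have hg_sub : g (algebraMap ℝ A ‖a‖ - a) ≤ ‖a‖ * ‖(1 : A)‖ :=
    (le_abs_self _).trans ((g.le_of_opNorm_le hg _).trans (by simpa using hnorm))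
  rw [map_sub, Algebra.algebraMap_eq_smul_one, map_smul, h1, smul_eq_mul] at hg_sub
  linarith

lemma exists_positiveLinearMap_eqOn_isSelfAdjoint (g : A →ₗ[ℝ] ℝ) (hg : ∀ a, 0 ≤ a → 0 ≤ g a) :
    ∃ f : A →ₚ[ℂ] ℂ, ∀ a, IsSelfAdjoint a → f a = g a := by
  let f : Module.Dual ℂ A :=
    Module.Dual.extendRCLike (g ∘ₗ (selfAdjoint.submodule ℝ A).subtype ∘ₗ realPart)
  have hf : ∀ a, IsSelfAdjoint a → f a = g a := fun a ha => by
    change (g (ℜ a : A) : ℂ) - Complex.I * g (ℜ (Complex.I • a) : A) = g a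
    simp [ha.coe_realPart, realPart_I_smul, ha.imaginaryPart]
  exact ⟨.mk₀ f fun a ha => by
    rw [hf a (.of_nonneg ha)]; exact Complex.zero_le_real.2 (hg a ha), hf⟩

/- A functional norming `1 + a* a` norms both summands, because
`‖1 + a* a‖ = ‖1‖ + ‖a* a‖`; norming `1` makes it positive. -/
lemma exists_positiveLinearMap_apply_star_mul_self (a : A) :
    ∃ f : A →ₚ[ℂ] ℂ, f 1 = ‖(1 : A)‖ ∧ f (star a * a) = (‖a‖ ^ 2 : ℝ) := by
  obtain ⟨g, hg, hga⟩ := exists_dual_vector'' ℝ (1 + star a * a)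
  rw [map_add, norm_one_add_of_nonneg (star_mul_self_nonneg a), RCLike.ofReal_real_eq_id,
    id_eq] at hga
  have hle : ∀ b, g b ≤ ‖b‖ := fun b =>
    (le_abs_self _).trans ((g.le_of_opNorm_le hg b).trans_eq (one_mul _))
  have h1 : g 1 = ‖(1 : A)‖ := by linarith [hle 1, hle (star a * a)]
  have ha : g (star a * a) = ‖star a * a‖ := by linarith [hle 1, hle (star a * a)]
  obtain ⟨f, hf⟩ := exists_positiveLinearMap_eqOn_isSelfAdjoint g.toLinearMap
    fun b hb => apply_nonneg_of_norm_le_one hg h1 hb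
  refine ⟨f, (hf 1 (.one A)).trans (congrArg _ h1), (hf _ (.star_mul_self a)).trans ?_⟩
  exact congrArg _ (ha.trans (CStarRing.norm_star_mul_self.trans (sq _).symm))

end FaithfulRepresentations

lemma exists_representation_norm_le {A : Type u} [CStarAlgebra A] (a : A) :
    ∃ (H : Type u) (_ : NormedAddCommGroup H) (_ : InnerProductSpace ℂ H)
      (_ : CompleteSpace H) (π : A →⋆ₐ[ℂ] (H →L[ℂ] H)), ‖a‖ ≤ ‖π a‖ := by
  let _ := CStarAlgebra.spectralOrder A
  have := CStarAlgebra.spectralOrderedRing A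
  obtain ⟨f, hf1, hfa⟩ := exists_positiveLinearMap_apply_star_mul_self a
  have hξ : ‖(f.toPreGNS 1 : f.GNS)‖ ≤ 1 := by
    have h1 : ‖(1 : A)‖ ≤ 1 := by nontriviality A; simp
    simpa [UniformSpace.Completion.norm_coe, PositiveLinearMap.preGNS_norm_def, hf1] using h1
  have hπξ : ‖f.gnsStarAlgHom a (f.toPreGNS 1 : f.GNS)‖ = ‖a‖ := by
    have : f.gnsStarAlgHom a (f.toPreGNS 1 : f.GNS) = (f.toPreGNS a : f.GNS) := by simp
    rw [this, UniformSpace.Completion.norm_coe, PositiveLinearMap.preGNS_norm_def,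
      PositiveLinearMap.ofPreGNS_toPreGNS, hfa, Complex.ofReal_re, Real.sqrt_sq (norm_nonneg a)]
  refine ⟨f.GNS, inferInstance, inferInstance, inferInstance, f.gnsStarAlgHom, ?_⟩
  exact hπξ.symm.le.trans (((f.gnsStarAlgHom a).le_opNorm_of_le hξ).trans_eq (mul_one _))

lemma starAlgHom_eq_of_eqOn_of_adjoin_dense {A : Type*} {B : Type*} [CStarAlgebra A]
    [CStarAlgebra B] {s : Set A} (hs : (StarAlgebra.adjoin ℂ s).topologicalClosure = ⊤)
    {φ ψ : A →⋆ₐ[ℂ] B} (h : s.EqOn φ ψ) : φ = ψ := by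
  have hcont : ∀ χ : A →⋆ₐ[ℂ] B, Continuous χ := fun χ =>
    AddMonoidHomClass.continuous_of_bound χ 1 fun a => by
      simpa using NonUnitalStarAlgHom.norm_apply_le χ a
  have hclosed : IsClosed (StarAlgHom.equalizer φ ψ : Set A) := isClosed_eq (hcont φ) (hcont ψ)
  have hle := StarSubalgebra.topologicalClosure_minimal (StarAlgHom.adjoin_le_equalizer φ ψ h)
    hclosed
  exact StarAlgHom.ext fun a => hle (hs.symm ▸ StarSubalgebra.mem_top)

namespace CStarSeminorm

variable {F : Type*} [Ring F] [StarRing F] [Algebra ℂ F]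

lemma sup_apply {S : Set (CStarSeminorm F)} (h : ∀ a, BddAbove (Set.range fun p : S => p.1 a))
    (a : F) : sup S a = ⨆ p : S, p.1 a := by
  rw [sup, dif_pos h]
  rfl

lemma le_sup {S : Set (CStarSeminorm F)} (h : ∀ a, BddAbove (Set.range fun p : S => p.1 a))
    {p : CStarSeminorm F} (hp : p ∈ S) (a : F) : p a ≤ sup S a :=
  (le_ciSup (h a) ⟨p, hp⟩).trans_eq (sup_apply h a).symm

lemma sup_apply_eq_zero {S : Set (CStarSeminorm F)} {a : F} (h : ∀ p ∈ S, p a = 0) :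
    sup S a = 0 := by
  by_cases hS : ∀ a, BddAbove (Set.range fun p : S => p.1 a)
  · rw [sup_apply hS]
    simp only [fun p : S => h p.1 p.2, Real.iSup_const_zero]
  · rw [sup, dif_neg hS]
    rfl

/-- The C*-seminorm `a ↦ ‖φ a‖` of a *-homomorphism `φ` to a C*-algebra. -/
def ofHom {D : Type*} [CStarAlgebra D] (φ : F →⋆ₐ[ℂ] D) : CStarSeminorm F where
  toSeminorm := (normSeminorm ℂ D).comp φ.toAlgHom.toLinearMap
  mul_le a b := by simpa using norm_mul_le (φ a) (φ b)
  star_mul_self a := by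
    change ‖φ (star a * a)‖ = ‖φ a‖ ^ 2
    rw [map_mul, map_star, CStarRing.norm_star_mul_self, sq]

lemma ofHom_apply {D : Type*} [CStarAlgebra D] (φ : F →⋆ₐ[ℂ] D) (a : F) : ofHom φ a = ‖φ a‖ := rfl

variable (p : CStarSeminorm F)

lemma toComplHom_eq_toComplHom_iff {a b : F} :
    p.toComplHom a = p.toComplHom b ↔ p (a - b) = 0 := by
  rw [← sub_eq_zero, ← map_sub, ← norm_eq_zero]
  exact Eq.congr_left (p.norm_toCompl _)

variable [StarModule ℂ F]

lemma exists_lift {D : Type*} [CStarAlgebra D] (φ : F →⋆ₐ[ℂ] D) (h : ∀ a, ‖φ a‖ ≤ p a) :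
    ∃ ψ : p.Completion →⋆ₐ[ℂ] D, ∀ a, ψ (p.toComplHom a) = φ a := by
  let φ' : p.Pre →+* D := (φ : F →+* D)
  have hφ' : Continuous φ' :=
    AddMonoidHomClass.continuous_of_bound φ' 1 fun a => (h a).trans_eq (one_mul _).symm
  let ψ := UniformSpace.Completion.extensionHom φ' hφ'
  have hψ : ∀ a : F, ψ (p.toCompl a) = φ a := UniformSpace.Completion.extensionHom_coe φ' hφ'
  have hψ_cont : Continuous ψ := UniformSpace.Completion.continuous_extension
  refine ⟨{ ψ with
    commutes' := fun c => ?_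
    map_star' := fun x => ?_ }, hψ⟩
  · calc ψ (algebraMap ℂ p.Completion c) = ψ (p.toCompl (algebraMap ℂ F c)) :=
          congrArg ψ (AlgHomClass.commutes p.toComplHom c).symm
      _ = algebraMap ℂ D c := (hψ _).trans (AlgHomClass.commutes φ c)
  · change ψ (star x) = star (ψ x)
    have := p.continuous_star'
    refine p.denseRange_toCompl.induction_on (p := fun x => ψ (star x) = star (ψ x)) x
      (isClosed_eq (by fun_prop) (by fun_prop)) fun a => ?_
    rw [← toCompl_star, hψ, hψ, map_star]

end CStarSeminorm

section SliceMap

variable {A : Type u} {B : Type v} [CStarAlgebra A] [CStarAlgebra B]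

lemma tensorRepSeminorm_le_minTensorSeminorm {H : Type u} [NormedAddCommGroup H]
    [InnerProductSpace ℂ H] [CompleteSpace H] {K : Type v} [NormedAddCommGroup K]
    [InnerProductSpace ℂ K] [CompleteSpace K] (π : A →⋆ₐ[ℂ] (H →L[ℂ] H))
    (ρ : B →⋆ₐ[ℂ] (K →L[ℂ] K)) (x : A ⊗[ℂ] B) :
    tensorRepSeminorm π ρ x ≤ minTensorSeminorm A B x := by
  refine CStarSeminorm.le_sup (p := tensorRepSeminorm π ρ) (fun y => ?_)
    (by exact ⟨H, _, _, _, K, _, _, _, π, ρ, rfl⟩) x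
  obtain ⟨C, hC⟩ := minTensorSeminorm_bddAbove A B y
  refine ⟨C, ?_⟩
  rintro _ ⟨⟨_, H, _, _, _, K, _, _, _, π, ρ, rfl⟩, rfl⟩
  exact hC H K π ρ

/-- The slice map `id ⊗ ε : a ⊗ b ↦ ε b • a` of a linear multiplicative functional `ε`, on the
algebraic tensor product. -/
def algSlice {R A B : Type*} [CommSemiring R] [Semiring A] [Algebra R A] [Semiring B] [Algebra R B]
    (ε : B →ₐ[R] R) : A ⊗[R] B →ₐ[R] A :=
  (Algebra.TensorProduct.rid R R A).toAlgHom.comp (Algebra.TensorProduct.map (.id R A) ε)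

lemma algSlice_tmul {R A B : Type*} [CommSemiring R] [Semiring A] [Algebra R A] [Semiring B]
    [Algebra R B] (ε : B →ₐ[R] R) (a : A) (b : B) : algSlice ε (a ⊗ₜ[R] b) = ε b • a := rfl

lemma algSlice_star (ε : B →⋆ₐ[ℂ] ℂ) (x : A ⊗[ℂ] B) :
    algSlice (ε : B →ₐ[ℂ] ℂ) (star x) = star (algSlice (ε : B →ₐ[ℂ] ℂ) x) := by
  induction x with
  | zero => simp
  | add x y hx hy => rw [star_add, map_add, hx, hy, map_add, star_add]
  | tmul a b => simp [TensorProduct.star_tmul, algSlice_tmul, map_star]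

/-- The representation of `B` by scalars on a Hilbert space that is given by a character `ε`. -/
def charRep (K : Type*) [NormedAddCommGroup K] [InnerProductSpace ℂ K] [CompleteSpace K]
    (ε : B →⋆ₐ[ℂ] ℂ) : B →⋆ₐ[ℂ] (K →L[ℂ] K) :=
  (StarAlgHom.ofId ℂ (K →L[ℂ] K)).comp ε

lemma charRep_apply {K : Type*} [NormedAddCommGroup K] [InnerProductSpace ℂ K] [CompleteSpace K]
    (ε : B →⋆ₐ[ℂ] ℂ) (b : B) (ξ : K) : charRep K ε b ξ = ε b • ξ := by
  simp [charRep, Algebra.algebraMap_eq_smul_one]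

lemma tensorRep_charRep_tmul {H K : Type*} [NormedAddCommGroup H] [InnerProductSpace ℂ H]
    [CompleteSpace H] [NormedAddCommGroup K] [InnerProductSpace ℂ K] [CompleteSpace K]
    (π : A →⋆ₐ[ℂ] (H →L[ℂ] H)) (ε : B →⋆ₐ[ℂ] ℂ) (x : A ⊗[ℂ] B) (h : H) (ξ : K) :
    tensorRep π (charRep K ε) x (h ⊗ₜ ξ) = π (algSlice (ε : B →ₐ[ℂ] ℂ) x) h ⊗ₜ ξ := by
  induction x with
  | zero => simp
  | add y z hy hz =>
    rw [map_add, add_apply, hy, hz, map_add, map_add, add_apply, TensorProduct.add_tmul]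
  | tmul a b =>
    rw [tensorRep_tmul, TensorProduct.mapL_tmul, algSlice_tmul, charRep_apply, map_smul,
      smul_apply, TensorProduct.tmul_smul, TensorProduct.smul_tmul']
    rfl

lemma norm_algSlice_le (ε : B →⋆ₐ[ℂ] ℂ) (x : A ⊗[ℂ] B) :
    ‖algSlice (ε : B →ₐ[ℂ] ℂ) x‖ ≤ minTensorSeminorm A B x := by
  obtain ⟨H, _, _, _, π, hπ⟩ := exists_representation_norm_le (algSlice (ε : B →ₐ[ℂ] ℂ) x)
  let ξ : EuclideanSpace ℂ PUnit.{v + 1} := EuclideanSpace.single PUnit.unit 1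
  have hξ : ‖ξ‖ = 1 := by simp [ξ]
  let ρ := charRep (EuclideanSpace ℂ PUnit.{v + 1}) ε
  refine hπ.trans (le_trans ?_ (tensorRepSeminorm_le_minTensorSeminorm π ρ x))
  refine ContinuousLinearMap.opNorm_le_bound _ ((tensorRepSeminorm π ρ).nonneg x) fun h => ?_
  have hbound := (tensorRep π ρ x).le_opNorm (h ⊗ₜ ξ)
  rwa [tensorRep_charRep_tmul, TensorProduct.norm_tmul, TensorProduct.norm_tmul, hξ, mul_one,
    mul_one] at hbound

lemma exists_minTensor_slice (A : Type u) [CStarAlgebra A] (ε : B →⋆ₐ[ℂ] ℂ) :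
    ∃ σ : MinTensor A B →⋆ₐ[ℂ] A, ∀ a b, σ (minTmul a b) = ε b • a := by
  let slice : A ⊗[ℂ] B →⋆ₐ[ℂ] A := { algSlice (ε : B →ₐ[ℂ] ℂ) with map_star' := algSlice_star ε }
  obtain ⟨σ, hσ⟩ := (minTensorSeminorm A B).exists_lift slice (norm_algSlice_le ε)
  exact ⟨σ, fun a b => (hσ _).trans (algSlice_tmul _ a b)⟩

end SliceMap

namespace FreeStarAlg

variable {X : Type*}

section Lift

variable {D : Type*} [Ring D] [StarRing D]

/-- The value of a letter under an assignment `y` of the generators; the letters `(g, true)`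
stand for adjoints. -/
def letterVal (y : X → D) (a : X × Bool) : D := if a.2 then star (y a.1) else y a.1

lemma lift_letterVal_wordStar (y : X → D) (w : FreeMonoid (X × Bool)) :
    FreeMonoid.lift (letterVal y) (wordStar w) = star (FreeMonoid.lift (letterVal y) w) := by
  induction w using FreeMonoid.inductionOn' with
  | one => simp [wordStar]
  | of_mul a w ih =>
    obtain ⟨g, b⟩ := a
    rw [wordStar_mul, map_mul, ih, map_mul, star_mul]
    cases b <;> simp [wordStar, letterVal]

variable [Algebra ℂ D] [StarModule ℂ D]

/-- The *-homomorphism from the free *-algebra that extends an assignment of the generators. -/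
def lift (y : X → D) : FreeStarAlg X →⋆ₐ[ℂ] D where
  __ := (MonoidAlgebra.lift ℂ D (FreeMonoid (X × Bool)) (FreeMonoid.lift (letterVal y)) :
    MonoidAlgebra ℂ (FreeMonoid (X × Bool)) →ₐ[ℂ] D)
  map_star' f := by
    let L : FreeStarAlg X →ₐ[ℂ] D :=
      MonoidAlgebra.lift ℂ D (FreeMonoid (X × Bool)) (FreeMonoid.lift (letterVal y))
    have hL : ∀ w c, L (mon w c) = c • FreeMonoid.lift (letterVal y) w := fun w c =>
      MonoidAlgebra.lift_single _ _ _
    change L (star f) = star (L f)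
    induction f using induction_mon with
    | zero => simp
    | add f g hf hg => rw [star_add, map_add, hf, hg, map_add, star_add]
    | mon w c => rw [star_mon, hL, hL, lift_letterVal_wordStar, star_smul]

lemma lift_gen (y : X → D) (g : X) : lift y (gen g) = y g := by
  refine (MonoidAlgebra.lift_single (R := ℂ) (A := D) (FreeMonoid.lift (letterVal y))
    (FreeMonoid.of (g, false)) 1).trans ?_
  simp [letterVal]

end Lift

lemma mon_mem_adjoin_range_gen (w : FreeMonoid (X × Bool)) :
    mon w 1 ∈ StarAlgebra.adjoin ℂ (Set.range (gen : X → FreeStarAlg X)) := by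
  induction w using FreeMonoid.inductionOn' with
  | one => exact one_mem _
  | of_mul a w ih =>
    obtain ⟨g, b⟩ := a
    rw [← one_mul (1 : ℂ), ← mon_mul]
    have hg := StarAlgebra.subset_adjoin ℂ (Set.range (gen : X → FreeStarAlg X)) ⟨g, rfl⟩
    cases b
    · exact mul_mem hg ih
    · exact mul_mem (star_gen g ▸ star_mem hg) ih

lemma adjoin_range_gen : StarAlgebra.adjoin ℂ (Set.range (gen : X → FreeStarAlg X)) = ⊤ := by
  refine eq_top_iff.2 fun f _ => ?_
  induction f using induction_mon with
  | zero => exact zero_mem _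
  | add f g hf hg => exact add_mem (hf trivial) (hg trivial)
  | mon w c =>
    rw [← mul_one c, ← smul_mon]
    exact SMulMemClass.smul_mem c (mon_mem_adjoin_range_gen w)

end FreeStarAlg

namespace UnivCStar

variable {X : Type u} (R : Set (FreeStarAlg X × FreeStarAlg X))

lemma adjoin_range_gen_dense :
    (StarAlgebra.adjoin ℂ (Set.range (gen R))).topologicalClosure = ⊤ := by
  have hrange : (univSeminorm R).toComplHom.range = StarAlgebra.adjoin ℂ (Set.range (gen R)) := by
    rw [StarAlgHom.range_eq_map_top, ← FreeStarAlg.adjoin_range_gen, StarAlgHom.map_adjoin,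
      ← Set.range_comp]
    rfl
  rw [← hrange]
  exact SetLike.coe_injective (univSeminorm R).denseRange_toCompl.closure_range

variable {R}

lemma toComplHom_eq_of_mem {r : FreeStarAlg X × FreeStarAlg X} (hr : r ∈ R) :
    (univSeminorm R).toComplHom r.1 = (univSeminorm R).toComplHom r.2 :=
  (univSeminorm R).toComplHom_eq_toComplHom_iff.2
    (CStarSeminorm.sup_apply_eq_zero fun _ hp => hp r hr)

lemma exists_hom (hR : ∀ f, BddAbove (Set.range fun p : {p : CStarSeminorm (FreeStarAlg X) |
      ∀ r ∈ R, p (r.1 - r.2) = 0} => p.1 f)) {D : Type*} [CStarAlgebra D] (y : X → D)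
    (hy : ∀ r ∈ R, FreeStarAlg.lift y r.1 = FreeStarAlg.lift y r.2) :
    ∃ φ : UnivCStar R →⋆ₐ[ℂ] D, ∀ g, φ (gen R g) = y g := by
  obtain ⟨φ, hφ⟩ := (univSeminorm R).exists_lift (FreeStarAlg.lift y)
    fun a => CStarSeminorm.le_sup (p := .ofHom (FreeStarAlg.lift y)) hR (fun r hr => by
      rw [CStarSeminorm.ofHom_apply, map_sub, hy r hr, sub_self, norm_zero]) a
  exact ⟨φ, fun g => (hφ _).trans (FreeStarAlg.lift_gen y g)⟩

end UnivCStar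

section IncidenceMatrix

open Matrix Finset

variable {ι τ τ' : Type*} [DecidableEq τ] [DecidableEq τ']

/-- A family of pairwise disjoint finite sets that all have the same nonzero number `c` of
elements. The sets `T_i` of valid labelings of a row form such a family. -/
structure IsUniformFamily (T : ι → Finset τ) (c : ℕ) : Prop where
  pairwise_disjoint : Pairwise fun i j => Disjoint (T i) (T j)
  card_eq : ∀ i, #(T i) = c
  card_ne_zero : c ≠ 0

omit [DecidableEq τ] in
lemma IsUniformFamily.nonempty {T : ι → Finset τ} {c : ℕ} (hT : IsUniformFamily T c) (i : ι) :
    (T i).Nonempty :=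
  Finset.card_ne_zero.1 (hT.card_eq i ▸ hT.card_ne_zero)

/-- The 0/1 matrix of the membership relation of a family of finite sets, whose rows are indexed
by the sets. -/
def incidenceMatrix (A : Type*) [Zero A] [One A] (T : ι → Finset τ) : Matrix ι τ A :=
  fun i t => if t ∈ T i then 1 else 0

section Semiring

variable {A : Type*} [Semiring A] {T : ι → Finset τ}

lemma incidenceMatrix_mul_apply [Fintype τ] {σ : Type*} (X : Matrix τ σ A) (i : ι) (γ : σ) :
    (incidenceMatrix A T * X) i γ = ∑ t ∈ T i, X t γ := by
  simp [incidenceMatrix, mul_apply]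

lemma transpose_incidenceMatrix_mul [Fintype τ] {σ : Type*} (X : Matrix τ σ A) :
    (incidenceMatrix A T * X)ᵀ = Xᵀ * (incidenceMatrix A T)ᵀ := by
  ext
  simp [incidenceMatrix, mul_apply]

lemma transpose_mul_incidenceMatrix [Fintype ι] {σ : Type*} (Y : Matrix σ ι A) :
    (Y * incidenceMatrix A T)ᵀ = (incidenceMatrix A T)ᵀ * Yᵀ := by
  ext
  simp [incidenceMatrix, mul_apply]

lemma conjTranspose_incidenceMatrix [StarRing A] :
    (incidenceMatrix A T)ᴴ = (incidenceMatrix A T)ᵀ := by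
  ext t i
  simp only [conjTranspose_apply, transpose_apply, incidenceMatrix]
  split_ifs <;> simp

lemma IsUniformFamily.incidenceMatrix_mul_transpose [Fintype τ] [DecidableEq ι] {c : ℕ}
    (hT : IsUniformFamily T c) : incidenceMatrix A T * (incidenceMatrix A T)ᵀ = c • 1 := by
  ext i j
  rw [incidenceMatrix_mul_apply, Matrix.smul_apply, one_apply]
  obtain rfl | hij := eq_or_ne i j
  · simp +contextual [incidenceMatrix, ← hT.card_eq i]
  · simp only [transpose_apply, incidenceMatrix, if_neg hij, smul_zero]
    exact sum_eq_zero fun t ht =>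
      if_neg (disjoint_left.1 (hT.pairwise_disjoint hij) ht)

variable [Fintype ι]

lemma mul_incidenceMatrix_apply_of_mem {σ : Type*}
    (hT : Pairwise fun i j => Disjoint (T i) (T j)) (Y : Matrix σ ι A) (s : σ) {j : ι} {γ : τ}
    (hγ : γ ∈ T j) : (Y * incidenceMatrix A T) s γ = Y s j := by
  rw [mul_apply, sum_eq_single_of_mem j (mem_univ j)]
  · simp [incidenceMatrix, hγ]
  · intro l _ hl
    rw [incidenceMatrix, if_neg (disjoint_right.1 (hT hl) hγ), mul_zero]

lemma mul_incidenceMatrix_apply_of_forall_notMem {σ : Type*} (Y : Matrix σ ι A) (s : σ) {γ : τ}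
    (hγ : ∀ j, γ ∉ T j) : (Y * incidenceMatrix A T) s γ = 0 := by
  simp [mul_apply, incidenceMatrix, hγ]

variable [Fintype τ] (hT : Pairwise fun i j => Disjoint (T i) (T j)) (X : Matrix τ τ A)
  (Y : Matrix ι ι A)
include hT

lemma incidenceMatrix_mul_eq_iff :
    incidenceMatrix A T * X = Y * incidenceMatrix A T ↔
      (∀ i j, ∀ γ ∈ T j, ∑ t ∈ T i, X t γ = Y i j) ∧
        ∀ i γ, (∀ j, γ ∉ T j) → ∑ t ∈ T i, X t γ = 0 := by
  refine ⟨fun h => ⟨fun i j γ hγ => ?_, fun i γ hγ => ?_⟩, fun h => ?_⟩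
  · rw [← incidenceMatrix_mul_apply, h, mul_incidenceMatrix_apply_of_mem hT Y i hγ]
  · rw [← incidenceMatrix_mul_apply, h, mul_incidenceMatrix_apply_of_forall_notMem Y i hγ]
  · ext i γ
    rw [incidenceMatrix_mul_apply]
    by_cases! hγ : ∃ j, γ ∈ T j
    · obtain ⟨j, hj⟩ := hγ
      rw [mul_incidenceMatrix_apply_of_mem hT Y i hj, h.1 i j γ hj]
    · rw [mul_incidenceMatrix_apply_of_forall_notMem Y i hγ, h.2 i γ hγ]

lemma mul_transpose_incidenceMatrix_eq_iff :
    X * (incidenceMatrix A T)ᵀ = (incidenceMatrix A T)ᵀ * Y ↔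
      (∀ i j, ∀ γ ∈ T i, ∑ t ∈ T j, X γ t = Y i j) ∧
        ∀ j γ, (∀ i, γ ∉ T i) → ∑ t ∈ T j, X γ t = 0 := by
  rw [← transpose_transpose Y, ← transpose_mul_incidenceMatrix, ← transpose_transpose X,
    ← transpose_incidenceMatrix_mul, transpose_inj, incidenceMatrix_mul_eq_iff hT]
  exact and_congr forall_comm Iff.rfl

end Semiring

section Adjoint

variable {A : Type*} [Semiring A] [StarRing A] [Fintype ι] [Fintype τ] {T : ι → Finset τ}
  {X : Matrix τ τ A} {Z : Matrix ι ι A}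

lemma incidenceMatrix_mul_conjTranspose_eq
    (h : X * (incidenceMatrix A T)ᵀ = (incidenceMatrix A T)ᵀ * Z) :
    incidenceMatrix A T * Xᴴ = Zᴴ * incidenceMatrix A T := by
  simpa [conjTranspose_mul, ← conjTranspose_incidenceMatrix] using congrArg conjTranspose h

lemma mul_transpose_incidenceMatrix_of_mul_conjTranspose [DecidableEq ι] (hX : X * Xᴴ = 1)
    (hZ : Zᴴ * Z = 1) (h : incidenceMatrix A T * X = Z * incidenceMatrix A T) :
    X * (incidenceMatrix A T)ᵀ = (incidenceMatrix A T)ᵀ * Z := by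
  have hadj : Xᴴ * (incidenceMatrix A T)ᵀ = (incidenceMatrix A T)ᵀ * Zᴴ := by
    simpa [conjTranspose_mul, conjTranspose_incidenceMatrix] using congrArg conjTranspose h
  calc X * (incidenceMatrix A T)ᵀ = X * ((incidenceMatrix A T)ᵀ * Zᴴ) * Z := by
        rw [Matrix.mul_assoc, Matrix.mul_assoc, hZ, Matrix.mul_one]
    _ = (incidenceMatrix A T)ᵀ * Z := by rw [← hadj, ← Matrix.mul_assoc X, hX, Matrix.one_mul]

end Adjoint

instance {m n A : Type*} [AddMonoid A] [IsAddTorsionFree A] : IsAddTorsionFree (Matrix m n A) :=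
  inferInstanceAs (IsAddTorsionFree (m → n → A))

section Intertwiner

variable {A : Type*} [Semiring A] [IsAddTorsionFree A] [Fintype ι] [Fintype τ] [Fintype τ']
  {T : ι → Finset τ} {T' : ι → Finset τ'} {c c' : ℕ} {X : Matrix τ τ A}
  {X' : Matrix τ' τ' A} {Y Z : Matrix ι ι A}

lemma IsUniformFamily.intertwiner_unique (hT : IsUniformFamily T c)
    (hY : incidenceMatrix A T * X = Y * incidenceMatrix A T)
    (hZ : X * (incidenceMatrix A T)ᵀ = (incidenceMatrix A T)ᵀ * Z) : Y = Z := by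
  classical
  refine nsmul_right_injective hT.card_ne_zero ?_
  calc c • Y = Y * incidenceMatrix A T * (incidenceMatrix A T)ᵀ := by
        rw [Matrix.mul_assoc, hT.incidenceMatrix_mul_transpose, Matrix.mul_smul, Matrix.mul_one]
    _ = incidenceMatrix A T * (incidenceMatrix A T)ᵀ * Z := by
        rw [← hY, Matrix.mul_assoc, hZ, Matrix.mul_assoc]
    _ = c • Z := by rw [hT.incidenceMatrix_mul_transpose, Matrix.smul_mul, Matrix.one_mul]

variable [StarRing A]

lemma IsUniformFamily.intertwiner_mul_conjTranspose [DecidableEq ι] (hT : IsUniformFamily T c)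
    (hX : X * Xᴴ = 1) (h : incidenceMatrix A T * X = Z * incidenceMatrix A T) : Z * Zᴴ = 1 := by
  refine nsmul_right_injective hT.card_ne_zero ?_
  calc c • (Z * Zᴴ) = Z * (incidenceMatrix A T * (incidenceMatrix A T)ᵀ) * Zᴴ := by
        rw [hT.incidenceMatrix_mul_transpose, Matrix.mul_smul, Matrix.mul_one, Matrix.smul_mul]
    _ = Z * incidenceMatrix A T * (Z * incidenceMatrix A T)ᴴ := by
        rw [conjTranspose_mul, conjTranspose_incidenceMatrix]
        simp only [Matrix.mul_assoc]
    _ = incidenceMatrix A T * (X * Xᴴ) * (incidenceMatrix A T)ᵀ := by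
        rw [← h, conjTranspose_mul, conjTranspose_incidenceMatrix]
        simp only [Matrix.mul_assoc]
    _ = c • 1 := by rw [hX, Matrix.mul_one, hT.incidenceMatrix_mul_transpose]

/-- The common intertwiner `Z` of two unitaries is itself unitary, one row giving `Z Zᴴ = 1`, the
other `Zᴴ Z = 1`; this allows passing to adjoints. -/
lemma IsUniformFamily.intertwiner_of_unitary (hT : IsUniformFamily T c)
    (hT' : IsUniformFamily T' c') (hX : X * Xᴴ = 1) (hX' : X'ᴴ * X' = 1)
    (h : incidenceMatrix A T * X = Z * incidenceMatrix A T)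
    (h' : X' * (incidenceMatrix A T')ᵀ = (incidenceMatrix A T')ᵀ * Z) :
    X * (incidenceMatrix A T)ᵀ = (incidenceMatrix A T)ᵀ * Z ∧
      incidenceMatrix A T' * X' = Z * incidenceMatrix A T' := by
  classical
  have hadj := incidenceMatrix_mul_conjTranspose_eq h'
  have hX'' : X'ᴴ * X'ᴴᴴ = 1 := by rwa [conjTranspose_conjTranspose]
  have hZ : Z * Zᴴ = 1 := hT.intertwiner_mul_conjTranspose hX h
  have hZ' : Zᴴ * Z = 1 := by
    simpa only [conjTranspose_conjTranspose] using hT'.intertwiner_mul_conjTranspose hX'' hadj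
  refine ⟨mul_transpose_incidenceMatrix_of_mul_conjTranspose hX hZ' h, ?_⟩
  have := incidenceMatrix_mul_conjTranspose_eq
    (mul_transpose_incidenceMatrix_of_mul_conjTranspose hX'' (by simpa using hZ) hadj)
  simpa only [conjTranspose_conjTranspose] using this

end Intertwiner

end IncidenceMatrix

section NoncommutativeKronecker

open Matrix Kronecker

lemma mul_kronecker_mul_of_commute {A l m n l' m' n' : Type*} [Semiring A] [Fintype m] [Fintype m']
    {M : Matrix l m A} {M' : Matrix m n A} {N : Matrix l' m' A} {N' : Matrix m' n' A}
    (h : ∀ i j k l, Commute (M' i j) (N k l)) :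
    (M * M') ⊗ₖ (N * N') = (M ⊗ₖ N) * (M' ⊗ₖ N') := by
  ext ⟨i, i'⟩ ⟨j, j'⟩
  simp only [kronecker_apply, mul_apply, Finset.sum_mul_sum, Fintype.sum_prod_type]
  exact Finset.sum_congr rfl fun k _ => Finset.sum_congr rfl fun k' _ =>
    (h k j i' k').mul_mul_mul_comm _ _

end NoncommutativeKronecker

namespace Color

variable {A B : Type*}

lemma map_act [Star A] [Star B] {F : Type*} [FunLike F A B] [StarHomClass F A B] (φ : F)
    (c : Color) (a : A) : φ (c.act a) = c.act (φ a) := by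
  cases c
  · rfl
  · exact map_star φ a

end Color

section WordMatrix

open Matrix Kronecker

variable {A : Type*} [Ring A] {N d n : ℕ}

/-- The matrix of all words `y^ω_{s,t}` of a fixed coloring `ω` in the entries of `y`. -/
def wordMatrix [Star A] (y : Matrix (Fin N) (Fin d) A) (ω : Fin n → Color) :
    Matrix (Fin n → Fin N) (Fin n → Fin d) A :=
  fun s t => wordProd y ω s t

lemma wordMatrix_transpose [Star A] (y : Matrix (Fin N) (Fin d) A) (ω : Fin n → Color) :
    wordMatrix yᵀ ω = (wordMatrix y ω)ᵀ := rfl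

lemma wordMatrix_succ [Star A] (y : Matrix (Fin N) (Fin d) A) (ω : Fin (n + 1) → Color) :
    wordMatrix y ω = (y.map (ω 0).act ⊗ₖ wordMatrix y (Fin.tail ω)).submatrix
      (Fin.consEquiv _).symm (Fin.consEquiv _).symm := by
  ext s t
  simp [wordMatrix, wordProd, List.ofFn_succ, Fin.consEquiv, Fin.tail]

lemma map_wordProd [Star A] {B F : Type*} [Ring B] [Star B] [FunLike F A B]
    [MonoidHomClass F A B] [StarHomClass F A B] (φ : F) (y : Matrix (Fin N) (Fin d) A)
    (ω : Fin n → Color) (s : Fin n → Fin N) (t : Fin n → Fin d) :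
    φ (wordProd y ω s t) = wordProd (y.map φ) ω s t := by
  simp [wordProd, map_list_prod, List.map_ofFn, Function.comp_def, Color.map_act]

lemma commute_wordMatrix [Star A] {a : A} {y : Matrix (Fin N) (Fin d) A}
    (h : ∀ (c : Color) i j, Commute a (c.act (y i j))) (ω : Fin n → Color) (s : Fin n → Fin N)
    (t : Fin n → Fin d) : Commute a (wordMatrix y ω s t) :=
  Commute.list_prod_right _ _ fun b hb => by
    obtain ⟨i, rfl⟩ := (List.mem_ofFn' _ _).1 hb
    exact h _ _ _

variable [StarRing A]

lemma wordMatrix_one (ω : Fin n → Color) : wordMatrix (1 : Matrix (Fin N) (Fin N) A) ω = 1 := by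
  induction n with
  | zero => ext s t; simp [wordMatrix, wordProd, one_apply, Subsingleton.elim s t]
  | succ n ih =>
    have hone : (1 : Matrix (Fin N) (Fin N) A).map (ω 0).act = 1 := by
      cases ω 0
      · rfl
      · exact Matrix.map_one _ (star_zero A) (star_one A)
    rw [wordMatrix_succ, ih, hone, one_kronecker_one, submatrix_one_equiv]

lemma wordMatrix_mul {m : ℕ} {a : Matrix (Fin m) (Fin N) A} {b : Matrix (Fin N) (Fin d) A}
    (h : ∀ (c c' : Color) i j k l, Commute (c.act (b i j)) (c'.act (a k l))) (ω : Fin n → Color) :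
    wordMatrix (a * b) ω = wordMatrix a ω * wordMatrix b ω := by
  induction n with
  | zero => ext; simp [wordMatrix, wordProd, mul_apply]
  | succ n ih =>
    have hmul (c : Color) : (a * b).map c.act = a.map c.act * b.map c.act := by
      ext i j
      cases c
      · rfl
      · simp only [map_apply, mul_apply, Color.act, star_sum, star_mul]
        exact Finset.sum_congr rfl fun k _ => h .black .black k j i k
    have hcomm : ∀ i j s t,
        Commute (b.map (ω 0).act i j) (wordMatrix a (Fin.tail ω) s t) := fun i j s t =>
      commute_wordMatrix (fun c k l => h (ω 0) c i j k l) _ s t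
    rw [wordMatrix_succ, ih, hmul, mul_kronecker_mul_of_commute hcomm,
      ← submatrix_mul_equiv _ _ _ (Fin.consEquiv fun _ => Fin N).symm, ← wordMatrix_succ,
      ← wordMatrix_succ]

/-- A square matrix `u` is biunitary if `u` and its entrywise adjoint `ū` are unitary; this is what
the relations of the mixed-coloured pair partitions say. The two conditions are indexed by the
colours. -/
def IsBiunitary (u : Matrix (Fin N) (Fin N) A) : Prop :=
  ∀ c : Color, u.map c.act ∈ unitary (Matrix (Fin N) (Fin N) A)

lemma IsBiunitary.wordMatrix_mem_unitary {u : Matrix (Fin N) (Fin N) A} (hu : IsBiunitary u)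
    (ω : Fin n → Color) :
    wordMatrix u ω ∈ unitary (Matrix (Fin n → Fin N) (Fin n → Fin N) A) := by
  induction n with
  | zero =>
    convert one_mem (unitary (Matrix (Fin 0 → Fin N) (Fin 0 → Fin N) A))
    ext s t
    simp [wordMatrix, wordProd, one_apply, Subsingleton.elim s t]
  | succ n ih =>
    have h := kronecker_mem_unitary (hu (ω 0)) (ih (Fin.tail ω))
    rw [wordMatrix_succ]
    simp only [Unitary.mem_iff, star_eq_conjTranspose, conjTranspose_submatrix,
      submatrix_mul_equiv] at h ⊢
    simp [h]

end WordMatrix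

section BlockLabelings

open Finset

variable {α Q ι κ : Type*} [Fintype α] [DecidableEq α] [Fintype κ] {q : α → Q} {b : ι → Q}

open Classical in
/-- The labelings of a row of points that are constant on blocks and have prescribed labels `i` on
some distinguished blocks `b`; here `q` maps a point to its block. -/
def blockLabelings (q : α → Q) (b : ι → Q) (i : ι → κ) : Finset (α → κ) :=
  {t | t.FactorsThrough q ∧ ∀ x s, q s = b x → t s = i x}

lemma mem_blockLabelings {i : ι → κ} {t : α → κ} :
    t ∈ blockLabelings q b i ↔ t.FactorsThrough q ∧ ∀ x s, q s = b x → t s = i x := by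
  simp [blockLabelings]

lemma pairwise_disjoint_blockLabelings (hb : ∀ x, ∃ s, q s = b x) :
    Pairwise fun i j : ι → κ => Disjoint (blockLabelings q b i) (blockLabelings q b j) := by
  refine fun i j hij => disjoint_left.2 fun t hi hj => hij (funext fun x => ?_)
  obtain ⟨s, hs⟩ := hb x
  exact ((mem_blockLabelings.1 hi).2 x s hs).symm.trans ((mem_blockLabelings.1 hj).2 x s hs)

lemma forall_notMem_blockLabelings_iff (hb : ∀ x, ∃ s, q s = b x) {t : α → κ} :
    (∀ i, t ∉ blockLabelings q b i) ↔ ¬ t.FactorsThrough q := by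
  refine ⟨fun h ht => ?_, fun h i hi => h (mem_blockLabelings.1 hi).1⟩
  choose s hs using hb
  exact h (fun x => t (s x)) (mem_blockLabelings.2 ⟨ht, fun x s' hs' => ht (hs'.trans (hs x).symm)⟩)

variable [AddCommGroup κ]

lemma add_extend_mem_blockLabelings (hb : b.Injective) {i : ι → κ} {t : α → κ}
    (ht : t ∈ blockLabelings q b i) (j : ι → κ) :
    t + b.extend (j - i) 0 ∘ q ∈ blockLabelings q b j := by
  rw [mem_blockLabelings] at ht ⊢
  refine ⟨fun s s' h => ?_, fun x s h => ?_⟩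
  · simp only [Pi.add_apply, Function.comp_apply, ht.1 h, h]
  · simp [ht.2 x s h, h, hb.extend_apply]

lemma card_blockLabelings_eq (hb : b.Injective) (i j : ι → κ) :
    #(blockLabelings q b i) = #(blockLabelings q b j) := by
  have hle (i j : ι → κ) : #(blockLabelings q b i) ≤ #(blockLabelings q b j) :=
    card_le_card_of_injOn _ (fun _ ht => add_extend_mem_blockLabelings hb ht j)
      (add_left_injective _).injOn
  exact (hle i j).antisymm (hle j i)

lemma isUniformFamily_blockLabelings (hb : b.Injective) (hq : ∀ x, ∃ s, q s = b x) :
    IsUniformFamily (blockLabelings (κ := κ) q b) #(blockLabelings (κ := κ) q b 0) where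
  pairwise_disjoint := pairwise_disjoint_blockLabelings hq
  card_eq i := card_blockLabelings_eq hb i 0
  card_ne_zero := by
    have h0 : 0 ∈ blockLabelings (κ := κ) q b 0 :=
      mem_blockLabelings.2 ⟨fun _ _ _ => rfl, fun _ _ _ => rfl⟩
    exact card_ne_zero_of_mem h0

end BlockLabelings

namespace ColPartition

variable {N : ℕ} (p : ColPartition)

instance : Finite p.ThroughBlock := inferInstanceAs (Finite (Subtype _))
instance : Fintype p.ThroughBlock := Fintype.ofFinite _
instance : DecidableEq p.ThroughBlock := Classical.decEq _

/-- The block of a through-block. -/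
def ThroughBlock.block : p.ThroughBlock → Quotient p.rel := Subtype.val

/-- The block of an upper point. -/
def upperBlock (s : Fin p.k) : Quotient p.rel := Quotient.mk p.rel (Sum.inl s)

/-- The block of a lower point. -/
def lowerBlock (s : Fin p.l) : Quotient p.rel := Quotient.mk p.rel (Sum.inr s)

variable {p}

lemma ThroughBlock.block_injective : (ThroughBlock.block p).Injective := Subtype.val_injective

lemma ThroughBlock.exists_upperBlock_eq (x : p.ThroughBlock) : ∃ s, p.upperBlock s = x.block :=
  x.2.1

lemma ThroughBlock.exists_lowerBlock_eq (x : p.ThroughBlock) : ∃ s, p.lowerBlock s = x.block :=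
  x.2.2

lemma validUpper_iff_factorsThrough {t : Fin p.k → Fin N} :
    p.ValidUpper t ↔ t.FactorsThrough p.upperBlock := by
  simp only [ValidUpper, Function.FactorsThrough, upperBlock, Quotient.eq]

lemma validLower_iff_factorsThrough {t : Fin p.l → Fin N} :
    p.ValidLower t ↔ t.FactorsThrough p.lowerBlock := by
  simp only [ValidLower, Function.FactorsThrough, lowerBlock, Quotient.eq]

lemma T_eq_blockLabelings :
    p.T (N := N) = blockLabelings p.upperBlock (ThroughBlock.block p) := by
  ext i t
  rw [mem_T, mem_blockLabelings, validUpper_iff_factorsThrough]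
  rfl

lemma T'_eq_blockLabelings :
    p.T' (N := N) = blockLabelings p.lowerBlock (ThroughBlock.block p) := by
  ext i t
  rw [mem_T', mem_blockLabelings, validLower_iff_factorsThrough]
  rfl

lemma forall_notMem_T_iff {t : Fin p.k → Fin N} : (∀ i, t ∉ p.T i) ↔ ¬ p.ValidUpper t := by
  rw [T_eq_blockLabelings, forall_notMem_blockLabelings_iff ThroughBlock.exists_upperBlock_eq,
    validUpper_iff_factorsThrough]

lemma forall_notMem_T'_iff {t : Fin p.l → Fin N} : (∀ i, t ∉ p.T' i) ↔ ¬ p.ValidLower t := by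
  rw [T'_eq_blockLabelings, forall_notMem_blockLabelings_iff ThroughBlock.exists_lowerBlock_eq,
    validLower_iff_factorsThrough]

variable (N p) [NeZero N]

lemma exists_isUniformFamily_T : ∃ c, IsUniformFamily (p.T (N := N)) c :=
  ⟨_, T_eq_blockLabelings ▸ isUniformFamily_blockLabelings ThroughBlock.block_injective
    ThroughBlock.exists_upperBlock_eq⟩

lemma exists_isUniformFamily_T' : ∃ c, IsUniformFamily (p.T' (N := N)) c :=
  ⟨_, T'_eq_blockLabelings ▸ isUniformFamily_blockLabelings ThroughBlock.block_injective
    ThroughBlock.exists_lowerBlock_eq⟩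

end ColPartition

section Relations

open Matrix

variable {A : Type*} [Ring A] {N : ℕ} {p : ColPartition}

lemma grRel_forall_iff [Star A] {u : Matrix (Fin N) (Fin N) A} {Q : A × A → Prop} :
    (∀ r, GrRel p u r → Q r) ↔
      (∀ i j, ∀ γ ∈ p.T j, ∀ γ' ∈ p.T' i, Q (∑ t ∈ p.T i, wordProd u p.upper t γ,
        ∑ t' ∈ p.T' j, wordProd u p.lower γ' t')) ∧
      (∀ i γ, ¬ p.ValidUpper γ → Q (∑ t ∈ p.T i, wordProd u p.upper t γ, 0)) ∧
      ∀ j γ', ¬ p.ValidLower γ' → Q (∑ t' ∈ p.T' j, wordProd u p.lower γ' t', 0) := by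
  refine ⟨fun h => ⟨fun i j γ hγ γ' hγ' => h _ (.both i j γ γ' hγ hγ'),
    fun i γ hγ => h _ (.upper i γ hγ), fun j γ' hγ' => h _ (.lower j γ' hγ')⟩, ?_⟩
  rintro ⟨hboth, hupper, hlower⟩ _ (⟨i, j, γ, γ', hγ, hγ'⟩ | ⟨i, γ, hγ⟩ | ⟨j, γ', hγ'⟩)
  exacts [hboth i j γ hγ γ' hγ', hupper i γ hγ, hlower j γ' hγ']

lemma spRel_forall_iff [Star A] {x : Matrix (Fin N) (Fin N) A} {Q : A × A → Prop} :
    (∀ r, SpRel (le_refl N) p x r → Q r) ↔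
      (∀ i j, ∀ γ ∈ p.T j, ∀ γ' ∈ p.T' j, Q (∑ t ∈ p.T i, wordProd x p.upper t γ,
        ∑ t' ∈ p.T' i, wordProd x p.lower t' γ')) ∧
      (∀ i γ, ¬ p.ValidUpper γ → Q (∑ t ∈ p.T i, wordProd x p.upper t γ, 0)) ∧
      ∀ i γ', ¬ p.ValidLower γ' → Q (∑ t' ∈ p.T' i, wordProd x p.lower t' γ', 0) := by
  refine ⟨fun h => ⟨fun i j γ hγ γ' hγ' => h _ (.both i j γ γ' hγ hγ'),
    fun i γ hγ => h _ (.upper i γ hγ), fun i γ' hγ' => h _ (.lower i γ' hγ')⟩, ?_⟩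
  rintro ⟨hboth, hupper, hlower⟩ _ (⟨i, j, γ, γ', hγ, hγ'⟩ | ⟨i, γ, hγ⟩ | ⟨i, γ', hγ'⟩)
  exacts [hboth i j γ hγ γ' hγ', hupper i γ hγ, hlower i γ' hγ']

/-- The matrix `u` satisfies the quantum group relations `R^Gr_p(u)`. -/
def SatisfiesGr [Star A] (p : ColPartition) (u : Matrix (Fin N) (Fin N) A) : Prop :=
  ∀ r, GrRel p u r → r.1 = r.2

/-- The matrix `x` satisfies the quantum space relations `R^Sp_p(x)` for `N` vectors. -/
def SatisfiesSp [Star A] (p : ColPartition) (x : Matrix (Fin N) (Fin N) A) : Prop :=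
  ∀ r, SpRel (le_refl N) p x r → r.1 = r.2

section Map

variable [Star A] {B F : Type*} [Ring B] [Star B] [FunLike F A B] [RingHomClass F A B]
  [StarHomClass F A B]

lemma satisfiesGr_map_iff {φ : F} {u : Matrix (Fin N) (Fin N) A} :
    SatisfiesGr p (u.map φ) ↔ ∀ r, GrRel p u r → φ r.1 = φ r.2 := by
  simp only [SatisfiesGr, grRel_forall_iff, map_sum, map_zero, map_wordProd]

lemma satisfiesSp_map_iff {φ : F} {x : Matrix (Fin N) (Fin N) A} :
    SatisfiesSp p (x.map φ) ↔ ∀ r, SpRel (le_refl N) p x r → φ r.1 = φ r.2 := by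
  simp only [SatisfiesSp, spRel_forall_iff, map_sum, map_zero, map_wordProd]

lemma SatisfiesGr.map {u : Matrix (Fin N) (Fin N) A} (h : SatisfiesGr p u) (φ : F) :
    SatisfiesGr p (u.map φ) :=
  satisfiesGr_map_iff.2 fun r hr => congrArg φ (h r hr)

lemma SatisfiesSp.map {x : Matrix (Fin N) (Fin N) A} (h : SatisfiesSp p x) (φ : F) :
    SatisfiesSp p (x.map φ) :=
  satisfiesSp_map_iff.2 fun r hr => congrArg φ (h r hr)

end Map

/-- The incidence matrix of the sets `T_i` of valid labelings of the upper row. -/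
abbrev ColPartition.upperIncidence (p : ColPartition) (N : ℕ) (A : Type*) [Zero A] [One A] :
    Matrix (p.ThroughBlock → Fin N) (Fin p.k → Fin N) A :=
  incidenceMatrix A p.T

/-- The incidence matrix of the sets `T'_i` of valid labelings of the lower row. -/
abbrev ColPartition.lowerIncidence (p : ColPartition) (N : ℕ) (A : Type*) [Zero A] [One A] :
    Matrix (p.ThroughBlock → Fin N) (Fin p.l → Fin N) A :=
  incidenceMatrix A p.T'

section Intertwiners

open ColPartition

variable [NeZero N]

lemma satisfiesGr_iff [Star A] {u : Matrix (Fin N) (Fin N) A} : SatisfiesGr p u ↔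
    ∃ Z : Matrix (p.ThroughBlock → Fin N) (p.ThroughBlock → Fin N) A,
      p.upperIncidence N A * wordMatrix u p.upper = Z * p.upperIncidence N A ∧
      wordMatrix u p.lower * (p.lowerIncidence N A)ᵀ = (p.lowerIncidence N A)ᵀ * Z := by
  obtain ⟨c, hT⟩ := p.exists_isUniformFamily_T N
  obtain ⟨c', hT'⟩ := p.exists_isUniformFamily_T' N
  simp only [incidenceMatrix_mul_eq_iff hT.pairwise_disjoint,
    mul_transpose_incidenceMatrix_eq_iff hT'.pairwise_disjoint, forall_notMem_T_iff,
    forall_notMem_T'_iff, SatisfiesGr, grRel_forall_iff]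
  constructor
  · rintro ⟨hboth, hupper, hlower⟩
    choose γ₀ hγ₀ using hT.nonempty
    choose γ₁ hγ₁ using hT'.nonempty
    refine ⟨fun i j => ∑ t ∈ p.T i, wordProd u p.upper t (γ₀ j),
      ⟨fun i j γ hγ => ?_, hupper⟩, fun i j γ' hγ' => (hboth i j _ (hγ₀ j) γ' hγ').symm, hlower⟩
    exact (hboth i j γ hγ _ (hγ₁ i)).trans (hboth i j _ (hγ₀ j) _ (hγ₁ i)).symm
  · rintro ⟨Z, ⟨hup, hupper⟩, hlow, hlower⟩
    exact ⟨fun i j γ hγ γ' hγ' => (hup i j γ hγ).trans (hlow i j γ' hγ').symm, hupper, hlower⟩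

lemma satisfiesSp_iff [Star A] {x : Matrix (Fin N) (Fin N) A} : SatisfiesSp p x ↔
    ∃ Y : Matrix (p.ThroughBlock → Fin N) (p.ThroughBlock → Fin N) A,
      p.upperIncidence N A * wordMatrix x p.upper = Y * p.upperIncidence N A ∧
      p.lowerIncidence N A * wordMatrix x p.lower = Y * p.lowerIncidence N A := by
  obtain ⟨c, hT⟩ := p.exists_isUniformFamily_T N
  obtain ⟨c', hT'⟩ := p.exists_isUniformFamily_T' N
  simp only [incidenceMatrix_mul_eq_iff hT.pairwise_disjoint,
    incidenceMatrix_mul_eq_iff hT'.pairwise_disjoint, forall_notMem_T_iff,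
    forall_notMem_T'_iff, SatisfiesSp, spRel_forall_iff]
  constructor
  · rintro ⟨hboth, hupper, hlower⟩
    choose γ₀ hγ₀ using hT.nonempty
    choose γ₁ hγ₁ using hT'.nonempty
    refine ⟨fun i j => ∑ t ∈ p.T i, wordProd x p.upper t (γ₀ j),
      ⟨fun i j γ hγ => ?_, hupper⟩, fun i j γ' hγ' => (hboth i j _ (hγ₀ j) γ' hγ').symm, hlower⟩
    exact (hboth i j γ hγ _ (hγ₁ j)).trans (hboth i j _ (hγ₀ j) _ (hγ₁ j)).symm
  · rintro ⟨Y, ⟨hup, hupper⟩, hlow, hlower⟩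
    exact ⟨fun i j γ hγ γ' hγ' => (hup i j γ hγ).trans (hlow i j γ' hγ').symm, hupper, hlower⟩

variable [StarRing A] {a b u : Matrix (Fin N) (Fin N) A}

lemma SatisfiesSp.mul (ha : SatisfiesSp p a) (hb : SatisfiesSp p b)
    (hcomm : ∀ (c c' : Color) i j k l, Commute (c.act (b i j)) (c'.act (a k l))) :
    SatisfiesSp p (a * b) := by
  obtain ⟨Y, hY, hY'⟩ := satisfiesSp_iff.1 ha
  obtain ⟨Z, hZ, hZ'⟩ := satisfiesSp_iff.1 hb
  refine satisfiesSp_iff.2 ⟨Y * Z, ?_, ?_⟩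
  · rw [wordMatrix_mul hcomm, ← Matrix.mul_assoc, hY, Matrix.mul_assoc, hZ, Matrix.mul_assoc]
  · rw [wordMatrix_mul hcomm, ← Matrix.mul_assoc, hY', Matrix.mul_assoc, hZ', Matrix.mul_assoc]

lemma SatisfiesGr.mul (ha : SatisfiesGr p a) (hb : SatisfiesGr p b)
    (hcomm : ∀ (c c' : Color) i j k l, Commute (c.act (b i j)) (c'.act (a k l))) :
    SatisfiesGr p (a * b) := by
  obtain ⟨Y, hY, hY'⟩ := satisfiesGr_iff.1 ha
  obtain ⟨Z, hZ, hZ'⟩ := satisfiesGr_iff.1 hb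
  refine satisfiesGr_iff.2 ⟨Y * Z, ?_, ?_⟩
  · rw [wordMatrix_mul hcomm, ← Matrix.mul_assoc, hY, Matrix.mul_assoc, hZ, Matrix.mul_assoc]
  · rw [wordMatrix_mul hcomm, Matrix.mul_assoc, hZ', ← Matrix.mul_assoc, hY', Matrix.mul_assoc]

lemma satisfiesSp_one : SatisfiesSp p (1 : Matrix (Fin N) (Fin N) A) :=
  satisfiesSp_iff.2 ⟨1, by rw [wordMatrix_one, Matrix.mul_one, Matrix.one_mul],
    by rw [wordMatrix_one, Matrix.mul_one, Matrix.one_mul]⟩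

lemma satisfiesSp_transpose_iff : SatisfiesSp p uᵀ ↔
    ∃ Z : Matrix (p.ThroughBlock → Fin N) (p.ThroughBlock → Fin N) A,
      wordMatrix u p.upper * (p.upperIncidence N A)ᵀ = (p.upperIncidence N A)ᵀ * Z ∧
      wordMatrix u p.lower * (p.lowerIncidence N A)ᵀ = (p.lowerIncidence N A)ᵀ * Z := by
  rw [satisfiesSp_iff, (transposeAddEquiv _ _ A).surjective.exists]
  simp only [wordMatrix_transpose, transposeAddEquiv_apply]
  refine exists_congr fun Z => and_congr ?_ ?_ <;>
    rw [← transpose_inj, transpose_incidenceMatrix_mul, transpose_mul_incidenceMatrix,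
      transpose_transpose, transpose_transpose]

variable [IsAddTorsionFree A]

lemma SatisfiesGr.exists_intertwiner (h : SatisfiesGr p u) (hu : IsBiunitary u) :
    ∃ Z : Matrix (p.ThroughBlock → Fin N) (p.ThroughBlock → Fin N) A,
      (p.upperIncidence N A * wordMatrix u p.upper = Z * p.upperIncidence N A ∧
        p.lowerIncidence N A * wordMatrix u p.lower = Z * p.lowerIncidence N A) ∧
      wordMatrix u p.upper * (p.upperIncidence N A)ᵀ = (p.upperIncidence N A)ᵀ * Z ∧
        wordMatrix u p.lower * (p.lowerIncidence N A)ᵀ = (p.lowerIncidence N A)ᵀ * Z := by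
  obtain ⟨c, hT⟩ := p.exists_isUniformFamily_T N
  obtain ⟨c', hT'⟩ := p.exists_isUniformFamily_T' N
  obtain ⟨Z, hZ, hZ'⟩ := satisfiesGr_iff.1 h
  obtain ⟨hadj, hadj'⟩ := hT.intertwiner_of_unitary hT' (hu.wordMatrix_mem_unitary p.upper).2
    (hu.wordMatrix_mem_unitary p.lower).1 hZ hZ'
  exact ⟨Z, ⟨hZ, hadj'⟩, hadj, hZ'⟩

lemma SatisfiesGr.satisfiesSp (h : SatisfiesGr p u) (hu : IsBiunitary u) : SatisfiesSp p u :=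
  let ⟨Z, hZ, _⟩ := h.exists_intertwiner hu
  satisfiesSp_iff.2 ⟨Z, hZ⟩

lemma SatisfiesGr.satisfiesSp_transpose (h : SatisfiesGr p u) (hu : IsBiunitary u) :
    SatisfiesSp p uᵀ :=
  let ⟨Z, _, hZ⟩ := h.exists_intertwiner hu
  satisfiesSp_transpose_iff.2 ⟨Z, hZ⟩

lemma SatisfiesSp.satisfiesGr (h : SatisfiesSp p u) (h' : SatisfiesSp p uᵀ) :
    SatisfiesGr p u := by
  obtain ⟨c, hT⟩ := p.exists_isUniformFamily_T N
  obtain ⟨Y, hY, -⟩ := satisfiesSp_iff.1 h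
  obtain ⟨Z, hZ, hZ'⟩ := satisfiesSp_transpose_iff.1 h'
  obtain rfl := hT.intertwiner_unique hY hZ
  exact satisfiesGr_iff.2 ⟨Y, hY, hZ'⟩

end Intertwiners

end Relations

namespace ColPartition

lemma upperPair_throughBlock {a b : Color} (x : (upperPair a b).ThroughBlock) : False :=
  Fin.elim0 x.2.2.choose

lemma mem_T'_upperPair {N : ℕ} {a b : Color} (i : (upperPair a b).ThroughBlock → Fin N)
    (t : Fin (upperPair a b).l → Fin N) : t ∈ (upperPair a b).T' i :=
  (mem_T' _).2 ⟨fun s => Fin.elim0 s, fun x => (upperPair_throughBlock x).elim⟩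

lemma const_mem_T_upperPair {N : ℕ} {a b : Color} (i : (upperPair a b).ThroughBlock → Fin N)
    (s : Fin N) : (fun _ => s) ∈ (upperPair a b).T i :=
  (mem_T _).2 ⟨fun _ _ _ => rfl, fun x => (upperPair_throughBlock x).elim⟩

lemma sum_T_upperPair {N : ℕ} {M : Type*} [AddCommMonoid M] {a b : Color}
    (i : (upperPair a b).ThroughBlock → Fin N) (f : (Fin (upperPair a b).k → Fin N) → M) :
    ∑ t ∈ (upperPair a b).T i, f t = ∑ s : Fin N, f (fun _ => s) := by
  symm
  refine Finset.sum_bij (fun s _ => fun _ => s) (fun s _ => const_mem_T_upperPair i s)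
    (fun s _ s' _ h => congrFun h (0 : Fin 2)) (fun t ht => ?_) (fun _ _ => rfl)
  exact ⟨t (0 : Fin 2), Finset.mem_univ _,
    funext fun s => ((mem_T _).1 ht).1 (0 : Fin 2) s trivial⟩

lemma sum_T'_upperPair {N : ℕ} {M : Type*} [AddCommMonoid M] {a b : Color}
    (i : (upperPair a b).ThroughBlock → Fin N) (f : (Fin (upperPair a b).l → Fin N) → M) :
    ∑ t ∈ (upperPair a b).T' i, f t = f (fun s => Fin.elim0 s) := by
  rw [Finset.sum_eq_single_of_mem _ (mem_T'_upperPair i _)]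
  exact fun t _ ht => (ht (funext fun s => Fin.elim0 s)).elim

end ColPartition

section MixedPairs

open ColPartition Matrix

variable {A : Type*} [Ring A] {N : ℕ} {a b : Color} {u : Matrix (Fin N) (Fin N) A}

lemma SatisfiesGr.lowerPair_mul_transpose [Star A] (h : SatisfiesGr (lowerPair a b) u) :
    u.map a.act * (u.map b.act)ᵀ = 1 := by
  obtain ⟨hboth, -, hlower⟩ := grRel_forall_iff.1 h
  simp only [sum_T'_lowerPair, sum_T_lowerPair] at hboth hlower
  let noBlock : (lowerPair a b).ThroughBlock → Fin N := fun x => (lowerPair_throughBlock x).elim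
  ext i j
  rw [mul_apply, one_apply]
  split_ifs with hij
  · subst hij
    simpa [wordProd, lowerPair, List.ofFn_succ] using (hboth noBlock noBlock _
      (mem_T_lowerPair _ (fun s => Fin.elim0 s)) _ (const_mem_T'_lowerPair _ i)).symm
  · simpa [wordProd, lowerPair, List.ofFn_succ] using hlower noBlock (![i, j] : Fin 2 → Fin N)
      fun hv => hij (hv (0 : Fin 2) (1 : Fin 2) trivial)

lemma SatisfiesGr.upperPair_transpose_mul [Star A] (h : SatisfiesGr (upperPair a b) u) :
    (u.map a.act)ᵀ * u.map b.act = 1 := by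
  obtain ⟨hboth, hupper, -⟩ := grRel_forall_iff.1 h
  simp only [sum_T'_upperPair, sum_T_upperPair] at hboth hupper
  let noBlock : (upperPair a b).ThroughBlock → Fin N := fun x => (upperPair_throughBlock x).elim
  ext i j
  rw [mul_apply, one_apply]
  split_ifs with hij
  · subst hij
    simpa [wordProd, upperPair, List.ofFn_succ] using hboth noBlock noBlock _
      (const_mem_T_upperPair _ i) _ (mem_T'_upperPair _ (fun s => Fin.elim0 s))
  · simpa [wordProd, upperPair, List.ofFn_succ] using hupper noBlock (![i, j] : Fin 2 → Fin N)
      fun hv => hij (hv (0 : Fin 2) (1 : Fin 2) trivial)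

lemma isBiunitary_of_satisfiesGr [StarRing A] (h : ∀ p ∈ mixedPairs, SatisfiesGr p u) :
    IsBiunitary u := by
  intro c
  rw [Unitary.mem_iff, star_eq_conjTranspose, conjTranspose]
  cases c
  · exact ⟨(h (upperPair .black .white) (by simp [mixedPairs])).upperPair_transpose_mul,
      (h (lowerPair .white .black) (by simp [mixedPairs])).lowerPair_mul_transpose⟩
  · have hstar : (u.map Color.black.act)ᵀ.map star = (u.map Color.white.act)ᵀ := by
      ext; exact star_star _
    rw [hstar]
    exact ⟨(h (upperPair .white .black) (by simp [mixedPairs])).upperPair_transpose_mul,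
      (h (lowerPair .black .white) (by simp [mixedPairs])).lowerPair_mul_transpose⟩

end MixedPairs

section UniversalProperties

variable {N : ℕ} {P : Set ColPartition}

lemma EasyQG.satisfiesGr {p : ColPartition} (hp : p ∈ P) : SatisfiesGr p (EasyQG.u N P) :=
  satisfiesGr_map_iff (φ := (univSeminorm (easyRelations N P)).toComplHom).2 fun _ hr =>
    UnivCStar.toComplHom_eq_of_mem ⟨p, hp, hr⟩

lemma PQS.satisfiesSp {p : ColPartition} (hp : p ∈ P) : SatisfiesSp p (PQS.x (le_refl N) P) :=
  satisfiesSp_map_iff (φ := (univSeminorm (pqsRelations (le_refl N) P)).toComplHom).2 fun _ hr =>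
    UnivCStar.toComplHom_eq_of_mem ⟨p, hp, hr⟩

lemma EasyQG.exists_hom (hP : ColPartition.mixedPairs ⊆ P) {D : Type*} [CStarAlgebra D]
    {v : Matrix (Fin N) (Fin N) D} (hv : ∀ p ∈ P, SatisfiesGr p v) :
    ∃ φ : EasyQG N P →⋆ₐ[ℂ] D, ∀ i j, φ (EasyQG.u N P i j) = v i j := by
  let φ := FreeStarAlg.lift fun g : Fin N × Fin N => v g.1 g.2
  have hφ : Matrix.map (fun i j => FreeStarAlg.gen (i, j)) φ = v :=
    Matrix.ext fun i j => FreeStarAlg.lift_gen _ (i, j)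
  obtain ⟨ψ, hψ⟩ := UnivCStar.exists_hom (easy_bddAbove N P hP) (fun g => v g.1 g.2)
    fun r ⟨p, hp, hr⟩ => satisfiesGr_map_iff.1 (hφ.symm ▸ hv p hp : SatisfiesGr p (.map _ φ)) r hr
  exact ⟨ψ, fun i j => hψ (i, j)⟩

lemma PQS.exists_hom (hP : ColPartition.mixedPairs ⊆ P) {D : Type*} [CStarAlgebra D]
    {x : Matrix (Fin N) (Fin N) D} (hx : ∀ p ∈ P, SatisfiesSp p x) :
    ∃ φ : PQS (le_refl N) P →⋆ₐ[ℂ] D, ∀ i j, φ (PQS.x (le_refl N) P i j) = x i j := by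
  let φ := FreeStarAlg.lift fun g : Fin N × Fin N => x g.1 g.2
  have hφ : Matrix.map (fun i j => FreeStarAlg.gen (i, j)) φ = x :=
    Matrix.ext fun i j => FreeStarAlg.lift_gen _ (i, j)
  obtain ⟨ψ, hψ⟩ := UnivCStar.exists_hom (pqs_bddAbove (le_refl N) P hP) (fun g => x g.1 g.2)
    fun r ⟨p, hp, hr⟩ => satisfiesSp_map_iff.1 (hφ.symm ▸ hx p hp : SatisfiesSp p (.map _ φ)) r hr
  exact ⟨ψ, fun i j => hψ (i, j)⟩

lemma EasyQG.isBiunitary (hP : ColPartition.mixedPairs ⊆ P) : IsBiunitary (EasyQG.u N P) :=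
  isBiunitary_of_satisfiesGr fun _ hp => EasyQG.satisfiesGr (hP hp)

end UniversalProperties

section MinTensorProduct

open Matrix

variable (A : Type u) (B : Type v) [CStarAlgebra A] [CStarAlgebra B]

/-- The canonical *-homomorphism `a ↦ a ⊗ 1` to the minimal tensor product. -/
def minTensorLeft : A →⋆ₐ[ℂ] MinTensor A B :=
  (minTensorSeminorm A B).toComplHom.comp
    { (Algebra.TensorProduct.includeLeft : A →ₐ[ℂ] A ⊗[ℂ] B) with
      map_star' := fun a => by
        change star a ⊗ₜ[ℂ] (1 : B) = star (a ⊗ₜ[ℂ] (1 : B))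
        rw [TensorProduct.star_tmul, star_one] }

/-- The canonical *-homomorphism `b ↦ 1 ⊗ b` to the minimal tensor product. -/
def minTensorRight : B →⋆ₐ[ℂ] MinTensor A B :=
  (minTensorSeminorm A B).toComplHom.comp
    { (Algebra.TensorProduct.includeRight : B →ₐ[ℂ] A ⊗[ℂ] B) with
      map_star' := fun b => by
        change (1 : A) ⊗ₜ[ℂ] star b = star ((1 : A) ⊗ₜ[ℂ] b)
        rw [TensorProduct.star_tmul, star_one] }

variable {A B}

lemma minTmul_mul_minTmul (a a' : A) (b b' : B) :
    minTmul a b * minTmul a' b' = minTmul (a * a') (b * b') := by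
  simp only [minTmul, ← map_mul, Algebra.TensorProduct.tmul_mul_tmul]

lemma minTensorLeft_mul_minTensorRight (a : A) (b : B) :
    minTensorLeft A B a * minTensorRight A B b = minTmul a b :=
  (minTmul_mul_minTmul a 1 1 b).trans (by rw [mul_one, one_mul])

lemma minTensorRight_mul_minTensorLeft (a : A) (b : B) :
    minTensorRight A B b * minTensorLeft A B a = minTmul a b :=
  (minTmul_mul_minTmul 1 a b 1).trans (by rw [mul_one, one_mul])

lemma commute_act_minTensorRight_act_minTensorLeft (c c' : Color) (a : A) (b : B) :
    Commute (c.act (minTensorRight A B b)) (c'.act (minTensorLeft A B a)) := by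
  rw [← Color.map_act, ← Color.map_act]
  exact (minTensorRight_mul_minTensorLeft _ _).trans (minTensorLeft_mul_minTensorRight _ _).symm

variable {N : ℕ} {p : ColPartition} {a : Matrix (Fin N) (Fin N) A} {b : Matrix (Fin N) (Fin N) B}

lemma map_minTensorLeft_mul_map_minTensorRight :
    a.map (minTensorLeft A B) * b.map (minTensorRight A B) =
      of fun i j => ∑ k, minTmul (a i k) (b k j) := by
  ext i j
  simp only [mul_apply, map_apply, of_apply, minTensorLeft_mul_minTensorRight]

variable [NeZero N]

lemma SatisfiesSp.minTmul (ha : SatisfiesSp p a) (hb : SatisfiesSp p b) :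
    SatisfiesSp p (of fun i j => ∑ k, minTmul (a i k) (b k j)) := by
  rw [← map_minTensorLeft_mul_map_minTensorRight]
  exact (ha.map (minTensorLeft A B)).mul (hb.map (minTensorRight A B))
    fun c c' _ _ _ _ => commute_act_minTensorRight_act_minTensorLeft c c' _ _

lemma SatisfiesGr.minTmul (ha : SatisfiesGr p a) (hb : SatisfiesGr p b) :
    SatisfiesGr p (of fun i j => ∑ k, minTmul (a i k) (b k j)) := by
  rw [← map_minTensorLeft_mul_map_minTensorRight]
  exact (ha.map (minTensorLeft A B)).mul (hb.map (minTensorRight A B))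
    fun c c' _ _ _ _ => commute_act_minTensorRight_act_minTensorLeft c c' _ _

end MinTensorProduct

section SymmetryGroup

open Matrix

variable {N : ℕ} {P : Set ColPartition}

lemma exists_starAlgEquiv_of_generates {A B m n : Type*} [CStarAlgebra A] [CStarAlgebra B]
    {u : Matrix m n A} {v : Matrix m n B}
    (hu : (StarAlgebra.adjoin ℂ {a : A | ∃ i j, a = u i j}).topologicalClosure = ⊤)
    (hv : (StarAlgebra.adjoin ℂ {b : B | ∃ i j, b = v i j}).topologicalClosure = ⊤)
    (φ : A →⋆ₐ[ℂ] B) (hφ : ∀ i j, φ (u i j) = v i j) (ψ : B →⋆ₐ[ℂ] A)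
    (hψ : ∀ i j, ψ (v i j) = u i j) : ∃ e : A ≃⋆ₐ[ℂ] B, ∀ i j, e (u i j) = v i j := by
  refine ⟨StarAlgEquiv.ofStarAlgHom φ ψ ?_ ?_, hφ⟩
  · refine starAlgHom_eq_of_eqOn_of_adjoin_dense hu ?_
    rintro _ ⟨i, j, rfl⟩
    simp [hφ, hψ]
  · refine starAlgHom_eq_of_eqOn_of_adjoin_dense hv ?_
    rintro _ ⟨i, j, rfl⟩
    simp [hφ, hψ]

lemma EasyQG.adjoin_u_dense :
    (StarAlgebra.adjoin ℂ {a | ∃ i j, a = EasyQG.u N P i j}).topologicalClosure = ⊤ := by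
  have hrange : {a | ∃ i j, a = EasyQG.u N P i j} =
      Set.range (UnivCStar.gen (easyRelations N P)) := by
    ext a
    simp only [Set.mem_ofPred_eq, Set.mem_range, Prod.exists, eq_comm (a := a)]
    rfl
  rw [hrange]
  exact UnivCStar.adjoin_range_gen_dense _

variable [NeZero N]

lemma EasyQG.isCMQG (hP : ColPartition.mixedPairs ⊆ P) : IsCMQG (EasyQG.u N P) where
  generates := EasyQG.adjoin_u_dense
  isUnit := Unitary.isUnit_coe (U := ⟨_, EasyQG.isBiunitary hP .white⟩)
  isUnit_conj := Unitary.isUnit_coe (U := ⟨_, EasyQG.isBiunitary hP .black⟩)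
  comul := EasyQG.exists_hom hP fun _ hp =>
    (EasyQG.satisfiesGr hp).minTmul (EasyQG.satisfiesGr hp)

lemma EasyQG.hasLeftAction (hP : ColPartition.mixedPairs ⊆ P) :
    HasLeftAction (EasyQG.u N P) (PQS.x (le_refl N) P) :=
  have : IsAddTorsionFree (EasyQG N P) := .of_isTorsionFree ℂ _
  PQS.exists_hom hP fun _ hp =>
    ((EasyQG.satisfiesGr hp).satisfiesSp (EasyQG.isBiunitary hP)).minTmul (PQS.satisfiesSp hp)

lemma EasyQG.hasRightAction (hP : ColPartition.mixedPairs ⊆ P) :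
    HasRightAction (EasyQG.u N P) (PQS.x (le_refl N) P) :=
  have : IsAddTorsionFree (EasyQG N P) := .of_isTorsionFree ℂ _
  PQS.exists_hom hP fun _ hp => ((EasyQG.satisfiesGr hp).satisfiesSp_transpose
    (EasyQG.isBiunitary hP)).minTmul (PQS.satisfiesSp hp)

variable {A : Type u} [CStarAlgebra A] {v : Matrix (Fin N) (Fin N) A}

/- Slice the action with the character `x_{ij} ↦ δ_{ij}`. -/
lemma HasLeftAction.satisfiesSp (h : HasLeftAction v (PQS.x (le_refl N) P))
    (hP : ColPartition.mixedPairs ⊆ P) {p : ColPartition} (hp : p ∈ P) : SatisfiesSp p v := by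
  obtain ⟨α, hα⟩ := h
  obtain ⟨ε, hε⟩ := PQS.exists_hom (D := ℂ) (N := N) hP fun _ _ => satisfiesSp_one
  obtain ⟨σ, hσ⟩ := exists_minTensor_slice A ε
  have hslice : (PQS.x (le_refl N) P).map (σ.comp α) = v := by
    ext i j
    simp [hα, hσ, hε, one_apply]
  exact hslice ▸ (PQS.satisfiesSp hp).map (σ.comp α)

lemma HasRightAction.satisfiesSp_transpose (h : HasRightAction v (PQS.x (le_refl N) P))
    (hP : ColPartition.mixedPairs ⊆ P) {p : ColPartition} (hp : p ∈ P) : SatisfiesSp p vᵀ :=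
  HasLeftAction.satisfiesSp (v := vᵀ) h hP hp

lemma EasyQG.isQuantumSymmetryGroup (hP : ColPartition.mixedPairs ⊆ P) :
    IsQuantumSymmetryGroup.{0, 0, w} (EasyQG.u N P) (PQS.x (le_refl N) P) where
  isCMQG := EasyQG.isCMQG hP
  left := EasyQG.hasLeftAction hP
  right := EasyQG.hasRightAction hP
  maximal A' _ _ _ hleft hright :=
    have : IsAddTorsionFree A' := .of_isTorsionFree ℂ A'
    EasyQG.exists_hom hP fun _ hp =>
      (hleft.satisfiesSp hP hp).satisfiesGr (hright.satisfiesSp_transpose hP hp)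

end SymmetryGroup

end

theorem mainTheorem4 (N : ℕ) (hN : 1 ≤ N) (P : Set ColPartition)
    (hP : ColPartition.mixedPairs ⊆ P) :
    IsQuantumSymmetryGroup.{0, 0, w} (EasyQG.u N P) (PQS.x (le_refl N) P) ∧
    ∀ (A : Type w) [CStarAlgebra A] (v : Matrix (Fin N) (Fin N) A),
      IsQuantumSymmetryGroup.{w, 0, 0} v (PQS.x (le_refl N) P) →
        ∃ e : EasyQG N P ≃⋆ₐ[ℂ] A, ∀ i j, e (EasyQG.u N P i j) = v i j := by
  have : NeZero N := ⟨by omega⟩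
  refine ⟨EasyQG.isQuantumSymmetryGroup hP, fun A _ v hv => ?_⟩
  have hu := EasyQG.isQuantumSymmetryGroup.{w} (N := N) hP
  obtain ⟨φ, hφ⟩ := hu.maximal A v hv.isCMQG hv.left hv.right
  obtain ⟨ψ, hψ⟩ := hv.maximal _ _ hu.isCMQG hu.left hu.right
  exact exists_starAlgEquiv_of_generates hu.isCMQG.generates hv.isCMQG.generates φ hφ ψ hψ
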